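/- **Setting.** Let $n\ge 2$ and let $H_n=\mathbb R^{2n+1}$ be the Heisenberg group with coordinates $(x^1,\dots,x^{2n},z)$, left-invariant horizontal frame $\hat e_j=\partial_{x^j}+x^{n+j}\partial_z$, $\hat e_{j'}=\partial_{x^{n+j}}-x^j\partial_z$ $(1\le j\le n)$, volume form $dv=dx^1\wedge\dots\wedge dx^{2n}\wedge dz$, and the degenerate inner product on covectors $\langle\omega,\eta\rangle^*=\sum_{j=1}^n\big(\omega(\hat e_j)\eta(\hat e_j)+\omega(\hat e_{j'})\eta(\hat e_{j'})\big)$, $|\omega|_*^2=\langle\omega,\omega\rangle^*$. Let $G(\eta)$ be the vector with $\omega(G(\eta))=\langle\omega,\eta\rangle^*$ for all $\omega$. For $a\in\mathbb R$ let $$l_a(x^1,\dots,x^{2n},z)=(x^1+a,x^2,\dots,x^{2n},z-a\,x^{n+1})$$ be the Heisenberg translation in the direction $\partial/\partial x^1$. **Mean curvature.** Let $p\ge 0$, let $\Sigma\subset H_n$ be a $C^\infty$ hypersurface near $q\in\Sigma$, and suppose that near $q$ it is $\{\phi=0\}$ for a $C^\infty$ function $\phi$ with $d\phi\ne0$, $|d\phi|_*\neq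 0$, which is compatible with the translations: $\phi(l_a(x))=\phi(x)-a$ for $x$ near $q$ and $a$ near $0$ (such a $\phi$ is determined by $\Sigma$ near $q$). Put $\nu_p=G(d\phi)/|d\phi|_*^{1-p}$ and let $dv_{\phi,p}$ be the $2n$-form $\nu_p\lrcorner dv$. The $p$-mean curvature $H_{\Sigma,p}$ is the continuous function on $\Sigma$ near $q$ given by the first variation formula $$\delta_{f\nu_p}\int_\Sigma dv_{\phi,p}=\int_\Sigma f\,H_{\Sigma,p}\,dv_{\phi,p}$$ for all smooth $f$ with compact support in $\Sigma$ near $q$, where $\delta_{f\nu_p}$ is the derivative at $t=0$ when $\Sigma$ moves with initial velocity $f\nu_p$ (the form $dv_{\phi,p}$ being kept fixed). **Corollary D.** Let $p\ge0$ and let $\Sigma_1,\Sigma_2\subset H_n$, $n\ge2$, be subsets containing $p_0$ that are $C^\infty$ hypersurfaces near $p_0$. Suppose that both have Euclidean unit normal $-\partial/\partial x^1$ at $p_0$ (so they are tangent at $p_0$ along a vertical hyperplane). Suppose that for all $q\in\Sigma_1$ near $p_0$ there is a number $a(q)\ge0$, with $a(q)\to0$ as $q\to p_0$, such that $l_{a(q)}(q)\in\Sigma_2$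 and $$H_{\Sigma_2,p}\big(l_{a(q)}(q)\big)\le H_{\Sigma_1,p}(q).$$ Then $\Sigma_1$ and $\Sigma_2$ coincide near $p_0$, i.e. $\Sigma_1\cap U=\Sigma_2\cap U$ for some neighborhood $U$ of $p_0$. -/

import Mathlib

open Filter MeasureTheory
open scoped Topology ContDiff

noncomputable section

namespace Heisenberg

/-- The Heisenberg group `H_n` in its global coordinates
`(x_1, …, x_n, y_1, …, y_n, z)`: `inl (inl j)` is the index of `x_j`, `inl (inr j)` that of
`y_j = x^{n+j}` and `inr ()` that of `z`. -/
abbrev Heis (n : ℕ) : Type := (Fin n ⊕ Fin n) ⊕ Unit → ℝ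

/-- The coordinate vector `∂/∂x_j`. -/
def ddx {n : ℕ} (j : Fin n) : Heis n := Pi.single (Sum.inl (Sum.inl j)) 1

/-- The coordinate vector `∂/∂y_j`. -/
def ddy {n : ℕ} (j : Fin n) : Heis n := Pi.single (Sum.inl (Sum.inr j)) 1

/-- The coordinate vector `∂/∂z`. -/
def ddz {n : ℕ} : Heis n := Pi.single (Sum.inr ()) 1

/-- The Heisenberg translation
`l_a (x_1, …, x_n, y_1, …, y_n, z) = (x_1 + a, x_2, …, x_n, y_1, …, y_n, z - a y_1)`, that is, left
multiplication by `(a, 0, …, 0)`. -/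
def lTrans {n : ℕ} [NeZero n] (a : ℝ) (q : Heis n) : Heis n :=
  q + a • (ddx 0 - q (Sum.inl (Sum.inr 0)) • ddz)

/-- The left invariant horizontal frame `ê_j = ∂/∂x_j + y_j ∂/∂z`, `ê_{j'} = ∂/∂y_j - x_j ∂/∂z`. -/
def frame {n : ℕ} : Fin n ⊕ Fin n → Heis n → Heis n
  | Sum.inl j, q => ddx j + q (Sum.inl (Sum.inr j)) • ddz
  | Sum.inr j, q => ddy j - q (Sum.inl (Sum.inl j)) • ddz

/-- The degenerate inner product `⟨·,·⟩^*` on the cotangent space at `q`, for which `dx_j`, `dy_j`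
are orthonormal and `Θ = dz + ∑ (x_j dy_j - y_j dx_j)` is in the kernel. (The coframe
`dx_j, dy_j, Θ` is dual to `ê_j, ê_{j'}, ∂/∂z`.) -/
def coInner {n : ℕ} (q : Heis n) (α η : Heis n →L[ℝ] ℝ) : ℝ :=
  ∑ k, α (frame k q) * η (frame k q)

/-- The length `|α|_*` of a covector at `q`. -/
def coNorm {n : ℕ} (q : Heis n) (α : Heis n →L[ℝ] ℝ) : ℝ := √(coInner q α α)

/-- The map `G : T^*_q → T_q` with `α (G η) = ⟨α, η⟩^*`. -/
def sharp {n : ℕ} (q : Heis n) (η : Heis n →L[ℝ] ℝ) : Heis n :=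
  ∑ k, η (frame k q) • frame k q

/-- The standard volume form `dx_1 ∧ … ∧ dx_n ∧ dy_1 ∧ … ∧ dy_n ∧ dz`
(`= dx_1 ∧ … ∧ dy_n ∧ Θ`). -/
def volForm (n : ℕ) : Heis n [⋀^(Fin n ⊕ Fin n) ⊕ Unit]→ₗ[ℝ] ℝ := Matrix.detRowAlternating

/-- The `p`-normal `ν_p = G(dφ) / |dφ|_*^{1-p}` of the level sets of `φ`. -/
def pNormal {n : ℕ} (p : ℝ) (φ : Heis n → ℝ) (q : Heis n) : Heis n :=
  (coNorm q (fderiv ℝ φ q) ^ (1 - p))⁻¹ • sharp q (fderiv ℝ φ q)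

/-- The `p`-area form `dv_{φ,p} = (dφ / |dφ|_*^{1-p}) ⌟ dv = ν_p ⌟ dv`, a `2n`-form. The vector
`ν_p` is put in the last slot; moving it there past `2n` vectors does not change the sign. -/
def areaForm {n : ℕ} (p : ℝ) (φ : Heis n → ℝ) (q : Heis n) (v : Fin n ⊕ Fin n → Heis n) : ℝ :=
  volForm n (Sum.elim v fun _ => pNormal p φ q)

/-- The coefficient at `y` of the pullback by `γ : ℝ^{2n} → H_n` of a `2n`-form `α`. -/
def pullback {n : ℕ} (α : Heis n → (Fin n ⊕ Fin n → Heis n) → ℝ)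
    (γ : (Fin n ⊕ Fin n → ℝ) → Heis n) (y : Fin n ⊕ Fin n → ℝ) : ℝ :=
  α (γ y) fun k => fderiv ℝ γ y (Pi.single k 1)

/-- `φ` is a smooth defining function of the hypersurface `S` in the open set `U`. -/
structure IsDefiningFunction {n : ℕ} (φ : Heis n → ℝ) (S U : Set (Heis n)) : Prop where
  isOpen : IsOpen U
  contDiffOn : ContDiffOn ℝ ∞ φ U
  fderiv_ne_zero : ∀ x ∈ U, fderiv ℝ φ x ≠ 0
  mem_iff : ∀ x ∈ U, x ∈ S ↔ φ x = 0

/-- `φ` is compatible in `U` with the translations `l_a`: `φ (l_a x) = φ x - a` for small `a`. -/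
def IsCompatible {n : ℕ} [NeZero n] (φ : Heis n → ℝ) (U : Set (Heis n)) : Prop :=
  ∃ δ > 0, ∀ x ∈ U, ∀ a : ℝ, |a| < δ → lTrans a x ∈ U → φ (lTrans a x) = φ x - a

/-- Near `q ∈ S` the set `S` is a smooth hypersurface whose Euclidean unit normal at `q` is `N`
(the Euclidean gradient at `q` of a defining function is a positive multiple of `N`). -/
def HasUnitNormalAt {n : ℕ} (S : Set (Heis n)) (q N : Heis n) : Prop :=
  q ∈ S ∧ N ⬝ᵥ N = 1 ∧ ∃ U φ, IsDefiningFunction φ S U ∧ q ∈ U ∧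
    ∃ c > 0, ∀ v, fderiv ℝ φ q v = c * (N ⬝ᵥ v)

/-- The continuous function `H` on `S ∩ V` satisfies the first variation formula
`δ_{f ν_p} ∫_S dv_{φ,p} = ∫_S f H dv_{φ,p}` for all test functions `f` supported in a coordinate
patch `γ : B → S ∩ V`; here `f` is written in the coordinates of the patch, and the variation moves
`γ y` to `γ y + t f(y) ν_p(γ y)`. The part of `S` outside the support of `f` does not move and is
left out of the integrals, so that all of them are over compact sets. -/
def SatisfiesFirstVariation {n : ℕ} (p : ℝ) (φ : Heis n → ℝ) (S V : Set (Heis n))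
    (H : Heis n → ℝ) : Prop :=
  ContinuousOn H (S ∩ V) ∧
    ∀ (B : Set (Fin n ⊕ Fin n → ℝ)) (γ : (Fin n ⊕ Fin n → ℝ) → Heis n),
      IsOpen B → ContDiffOn ℝ ∞ γ B → Set.InjOn γ B →
      (∀ y ∈ B, Function.Injective (fderiv ℝ γ y)) → Set.MapsTo γ B (S ∩ V) →
      ∀ f : (Fin n ⊕ Fin n → ℝ) → ℝ, ContDiff ℝ ∞ f → HasCompactSupport f → tsupport f ⊆ B →
        HasDerivAt
          (fun t : ℝ => ∫ y in tsupport f,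
            pullback (areaForm p φ) (fun w => γ w + (t * f w) • pNormal p φ (γ w)) y)
          (∫ y in tsupport f, f y * H (γ y) * pullback (areaForm p φ) γ y) 0

/-- `h` is the value at the nonsingular point `q ∈ S` of the `p`-mean curvature of `S`, computed with
a defining function near `q` that is compatible with the translations `l_a`. (Such a function is
determined by `S` near `q`.) -/
def IsMeanCurvatureAt {n : ℕ} [NeZero n] (S : Set (Heis n)) (p : ℝ) (q : Heis n) (h : ℝ) : Prop :=
  q ∈ S ∧ ∃ V φ, IsDefiningFunction φ S V ∧ q ∈ V ∧ IsCompatible φ V ∧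
    (∀ x ∈ V, coNorm x (fderiv ℝ φ x) ≠ 0) ∧
    ∃ H : Heis n → ℝ, SatisfiesFirstVariation p φ S V H ∧ H q = h

open Classical in
/-- The `p`-mean curvature `H_{S,p}(q)` (with the value `0` where it is not defined). -/
def meanCurvature {n : ℕ} [NeZero n] (S : Set (Heis n)) (p : ℝ) (q : Heis n) : ℝ :=
  if h : ∃ c, IsMeanCurvatureAt S p q c then h.choose else 0

end Heisenberg

end

/-!
Along the orbits of the translations `l_a` the coordinate `x_1` is a parameter, and the horizontal
frame is invariant under them. So a hypersurface with unit normal `-∂/∂x_1` at a point is a graph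
`x_1 = u` over the `2n`-dimensional orbit space, and its mean curvature is a quasilinear degenerate
elliptic operator in `u`, whose derivatives are taken along the projected frame only. The hypotheses
say `u₁ ≤ u₂`, with equality at the orbit of `p₀`, and the reversed inequality for the operators.

On the coincidence set `Z = {u₁ = u₂}` the strong maximum principle for degenerate operators
applies: touching `Z` by test functions `Φ + α (Φ - Φ z)²` with `α → ∞` shows that a proximal normal
to `Z` annihilates the horizontal directions tangent to the graph. By Bony's theorem `Z` is then
invariant under the flows of these fields, hence, by commuting flows, its proximal normals
annihilate the brackets as well. For `n ≥ 2` the fields and their brackets span at `p₀`, and a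
closed set with no nonzero proximal normals near one of its points is a neighbourhood of it.
-/

noncomputable section

namespace Heisenberg

/-! ### Closed sets invariant under vector fields -/

section ProximalNormals

variable {E : Type*} [NormedAddCommGroup E] [NormedSpace ℝ E]

/-- The covector `ℓ` is a proximal normal of `Z` at `z`: near `z` the set `Z` lies on one side of a
paraboloid whose conormal at `z` is `ℓ`. A vector `v` is tangent to `Z` in the sense of Bony when
all proximal normals annihilate it. -/
def IsProximalNormal (Z : Set E) (z : E) (ℓ : E →L[ℝ] ℝ) : Prop :=
  ∃ C, ∀ᶠ x in 𝓝[Z] z, ℓ (x - z) ≤ C * ‖x - z‖ ^ 2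

variable {Z : Set E} {w : E}

theorem IsProximalNormal.apply_nonpos_of_isLittleO {ℓ : E →L[ℝ] ℝ} (hℓ : IsProximalNormal Z w ℓ)
    {l : Filter ℝ} [l.NeBot] {β : ℝ → E} {g : ℝ → ℝ} {v : E} (hβZ : ∀ᶠ t in l, β t ∈ Z)
    (hg : Tendsto g l (𝓝[>] 0)) (hβ : (fun t => β t - w - g t • v) =o[l] g) : ℓ v ≤ 0 := by
  obtain ⟨C, hC⟩ := hℓ
  rw [tendsto_nhdsWithin_iff] at hg
  have hdir : Tendsto (fun t => (g t)⁻¹ • (β t - w)) l (𝓝 v) := by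
    refine ((hβ.tendsto_inv_smul_nhds_zero).add_const v).congr' ?_ |>.trans (by simp)
    filter_upwards [hg.2] with t (ht : 0 < g t)
    rw [smul_sub, inv_smul_smul₀ ht.ne', sub_add_cancel]
  have hβw : Tendsto β l (𝓝[Z] w) := by
    refine tendsto_nhdsWithin_iff.2 ⟨?_, hβZ⟩
    refine (((hg.1.smul hdir).add_const w).congr' ?_).trans (by simp)
    filter_upwards [hg.2] with t (ht : 0 < g t)
    rw [smul_inv_smul₀ ht.ne', sub_add_cancel]
  refine le_of_tendsto_of_tendsto ((ℓ.continuous.tendsto v).comp hdir)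
    (((hg.1.const_mul C).mul (hdir.norm.pow 2)).trans (by simp)) ?_
  filter_upwards [hβw.eventually hC, hg.2] with t ht (hgt : 0 < g t)
  have hscale : β t - w = g t • (g t)⁻¹ • (β t - w) := (smul_inv_smul₀ hgt.ne' _).symm
  rw [hscale, map_smul, norm_smul, Real.norm_of_nonneg hgt.le, smul_eq_mul] at ht
  refine le_of_mul_le_mul_left (ht.trans_eq ?_) hgt
  ring

variable [FiniteDimensional ℝ E]

theorem eventually_exists_nearest (hZ : IsClosed Z) (hw : w ∈ Z) {P : E → Prop}
    (hP : ∀ᶠ z in 𝓝 w, P z) :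
    ∀ᶠ p in 𝓝 w, ∃ z ∈ Z, P z ∧
      dist (toEuclidean p) (toEuclidean z) = Metric.infDist (toEuclidean p) (toEuclidean '' Z) := by
  obtain ⟨r, hr, hball⟩ := Euclidean.nhds_basis_ball.mem_iff.1 hP
  have hclosed : IsClosed (toEuclidean '' Z) := toEuclidean.toHomeomorph.isClosed_image.2 hZ
  filter_upwards [Euclidean.ball_mem_nhds (half_pos hr)] with p hp
  obtain ⟨-, ⟨z, hz, rfl⟩, hdist⟩ :=
    hclosed.exists_infDist_eq_dist (Set.Nonempty.image _ ⟨w, hw⟩) (toEuclidean p)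
  refine ⟨z, hz, hball ?_, hdist.symm⟩
  have hzw : dist (toEuclidean p) (toEuclidean z) ≤ dist (toEuclidean p) (toEuclidean w) :=
    hdist ▸ Metric.infDist_le_dist_of_mem (Set.mem_image_of_mem _ hw)
  have hpw : dist (toEuclidean p) (toEuclidean w) < r / 2 := hp
  change dist (toEuclidean z) (toEuclidean w) < r
  linarith [dist_triangle_left (toEuclidean z) (toEuclidean w) (toEuclidean p)]

theorem isProximalNormal_of_dist_eq_infDist {p z : E}
    (h : dist (toEuclidean p) (toEuclidean z) =
      Metric.infDist (toEuclidean p) (toEuclidean '' Z)) :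
    IsProximalNormal Z z (innerSL ℝ (toEuclidean (p - z)) ∘L
      (toEuclidean (E := E)).toContinuousLinearMap) := by
  refine ⟨‖(toEuclidean (E := E)).toContinuousLinearMap‖ ^ 2,
    eventually_nhdsWithin_of_forall fun x hx => ?_⟩
  have hnear : ‖toEuclidean (p - z)‖ ≤ ‖toEuclidean (p - z) - toEuclidean (x - z)‖ := by
    rw [map_sub, map_sub, sub_sub_sub_cancel_right, ← dist_eq_norm, ← dist_eq_norm, h]
    exact Metric.infDist_le_dist_of_mem (Set.mem_image_of_mem _ hx)
  have hop : ‖toEuclidean (x - z)‖ ≤ ‖(toEuclidean (E := E)).toContinuousLinearMap‖ * ‖x - z‖ :=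
    (toEuclidean (E := E)).toContinuousLinearMap.le_opNorm _
  have hsq := norm_sub_sq_real (toEuclidean (p - z)) (toEuclidean (x - z))
  rw [← mul_pow]
  simp only [ContinuousLinearMap.comp_apply, ContinuousLinearEquiv.coe_coe, innerSL_apply_apply]
  nlinarith [pow_le_pow_left₀ (norm_nonneg _) hnear 2, pow_le_pow_left₀ (norm_nonneg _) hop 2]

theorem mem_nhds_of_eventually_isProximalNormal_eq_zero (hZ : IsClosed Z) (hw : w ∈ Z)
    (h : ∀ᶠ z in 𝓝 w, z ∈ Z → ∀ ℓ, IsProximalNormal Z z ℓ → ℓ = 0) : Z ∈ 𝓝 w := by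
  filter_upwards [eventually_exists_nearest hZ hw h] with p ⟨z, hz, hnormal, hdist⟩
  have hself : inner ℝ (toEuclidean (p - z)) (toEuclidean (p - z)) = 0 :=
    DFunLike.congr_fun (hnormal hz _ (isProximalNormal_of_dist_eq_infDist hdist)) (p - z)
  have hpz : p - z = 0 := toEuclidean.map_eq_zero_iff.1 (inner_self_eq_zero.1 hself)
  exact sub_eq_zero.1 hpz ▸ hz

theorem IsProximalNormal.exists_contDiff {z : E} {ℓ : E →L[ℝ] ℝ} (hℓ : IsProximalNormal Z z ℓ) :
    ∃ Φ : E → ℝ, ContDiff ℝ ∞ Φ ∧ fderiv ℝ Φ z = ℓ ∧ ∀ᶠ x in 𝓝[Z] z, Φ x ≤ Φ z := by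
  obtain ⟨C, hC⟩ := hℓ
  set c := ‖(toEuclidean (E := E)).symm.toContinuousLinearMap‖
  refine ⟨fun x => ℓ (x - z) - (|C| * c ^ 2) * ‖toEuclidean (x - z)‖ ^ 2, ?_, ?_, ?_⟩
  · have : ContDiff ℝ ∞ fun x : E => toEuclidean (x - z) := by fun_prop
    exact (by fun_prop : ContDiff ℝ ∞ fun x => ℓ (x - z)).sub (contDiff_const.mul (this.norm_sq ℝ))
  · have hlin : HasFDerivAt (fun x => ℓ (x - z)) ℓ z :=
      ℓ.hasFDerivAt.comp z (hasFDerivAt_sub_const z)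
    have hsq := ((toEuclidean.hasFDerivAt.comp z (hasFDerivAt_sub_const z)).norm_sq.const_mul
      (|C| * c ^ 2))
    refine (hlin.sub hsq).fderiv.trans ?_
    ext v
    simp
  · filter_upwards [hC] with x hx
    have hxz : ‖x - z‖ ≤ c * ‖toEuclidean (x - z)‖ := by
      simpa using (toEuclidean (E := E)).symm.toContinuousLinearMap.le_opNorm (toEuclidean (x - z))
    have hbound : C * ‖x - z‖ ^ 2 ≤ |C| * (c * ‖toEuclidean (x - z)‖) ^ 2 := by
      gcongr
      exact le_abs_self C
    simp only [sub_self, map_zero, norm_zero]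
    linarith

end ProximalNormals

section IntegralCurves

variable {E : Type*} [NormedAddCommGroup E] [NormedSpace ℝ E] {X : E → E} {w : E}

theorem eventually_exists_integralCurve [CompleteSpace E] (hX : ContDiffAt ℝ 1 X w) :
    ∀ᶠ r : ℝ × E in 𝓝[≥] 0 ×ˢ 𝓝 w, ∃ γ : ℝ → E, γ 0 = r.2 ∧ ∀ s ∈ Set.Icc 0 r.1,
      HasDerivAt γ (X (γ s)) s ∧ ‖γ s - r.2‖ ≤ (‖X w‖ + 1) * s := by
  obtain ⟨r, hr, T, hT, hcurve⟩ :=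
    hX.exists_forall_mem_closedBall_exists_eq_forall_mem_Ioo_hasDerivAt 0
  obtain ⟨ρ, hρ, hXρ⟩ := Metric.nhds_basis_closedBall.mem_iff.1
    (hX.continuousAt.norm.eventually_lt_const (lt_add_one ‖X w‖))
  have hsmall : ∀ᶠ r : ℝ × E in 𝓝[≥] 0 ×ˢ 𝓝 w, (‖X w‖ + 1) * r.1 + ‖r.2 - w‖ < ρ := by
    have : Tendsto (fun r : ℝ × E => (‖X w‖ + 1) * r.1 + ‖r.2 - w‖) (𝓝 0 ×ˢ 𝓝 w) (𝓝 0) := by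
      rw [← nhds_prod_eq]
      exact Continuous.tendsto' (by fun_prop) _ _ (by simp)
    exact (this.mono_left (prod_mono_left _ nhdsWithin_le_nhds)).eventually_lt_const hρ
  have hT' : ∀ᶠ t in 𝓝[≥] (0 : ℝ), t ∈ Set.Ico 0 T := Ico_mem_nhdsGE hT
  filter_upwards [hsmall, hT'.prod_mk (Metric.closedBall_mem_nhds w hr)] with ⟨t, p⟩ ht ⟨htT, hp⟩
  simp only at ht htT hp ⊢
  obtain ⟨γ, rfl, hγ⟩ := hcurve p hp
  have hderiv : ∀ s ∈ Set.Icc 0 t, HasDerivAt γ (X (γ s)) s :=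
    fun s hs => hγ s ⟨by linarith [hs.1], by linarith [hs.2, htT.2]⟩
  refine ⟨γ, rfl, fun s hs => ⟨hderiv s hs, ?_⟩⟩
  refine image_norm_le_of_norm_deriv_right_lt_deriv_boundary (f := fun s => γ s - γ 0)
    (f' := fun s => X (γ s)) (B := fun s => (‖X w‖ + 1) * s) (B' := fun _ => ‖X w‖ + 1)
    (fun s hs => ((hderiv s hs).continuousAt.sub continuousAt_const).continuousWithinAt)
    (fun s hs => ((hderiv s (Set.Ico_subset_Icc_self hs)).sub_const _).hasDerivWithinAt)
    (by simp) (fun s => by simpa using (hasDerivAt_id s).const_mul (‖X w‖ + 1))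
    (fun s hs heq => hXρ ?_) hs
  rw [mem_closedBall_iff_norm]
  have : (‖X w‖ + 1) * s ≤ (‖X w‖ + 1) * t := by gcongr; exact hs.2.le
  linarith [norm_sub_le_norm_sub_add_norm_sub (γ s) (γ 0) w]

theorem norm_integralCurve_sub_taylor_le {A : E →L[ℝ] E} {γ : ℝ → E} {t η R : ℝ} (ht : 0 ≤ t)
    (hη : 0 ≤ η) (hγ : ∀ s ∈ Set.Icc 0 t, HasDerivAt γ (X (γ s)) s)
    (hγw : ∀ s ∈ Set.Icc 0 t, ‖γ s - w‖ ≤ R)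
    (hX : ∀ s ∈ Set.Icc 0 t, ‖X (γ s) - X w - A (γ s - w)‖ ≤ η * ‖γ s - w‖) :
    ‖γ t - γ 0 - t • (X w + A (γ 0 - w)) - (t ^ 2 / 2) • A (X w)‖ ≤
      (η * R + ‖A‖ * ((‖A‖ + η) * R * t)) * t := by
  have hη' : ∀ s ∈ Set.Icc 0 t, ‖X (γ s) - X w - A (γ s - w)‖ ≤ η * R := fun s hs =>
    (hX s hs).trans (by gcongr; exact hγw s hs)
  have hmem : t ∈ Set.Icc 0 t := ⟨ht, le_rfl⟩
  have hR : 0 ≤ R := (norm_nonneg _).trans (hγw t hmem)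
  have hspeed : ∀ s ∈ Set.Icc 0 t, ‖X (γ s) - X w‖ ≤ (‖A‖ + η) * R := fun s hs => by
    have hA : ‖A (γ s - w)‖ ≤ ‖A‖ * R := A.le_opNorm_of_le (hγw s hs)
    linarith [norm_sub_norm_le (X (γ s) - X w) (A (γ s - w)), hη' s hs]
  have hfirst : ∀ s ∈ Set.Icc 0 t, ‖γ s - γ 0 - s • X w‖ ≤ (‖A‖ + η) * R * t := fun s hs => by
    have h := norm_image_sub_le_of_norm_deriv_le_segment' (f := fun s => γ s - s • X w)
      (fun s hs => ((hγ s hs).sub ((hasDerivAt_id s).smul_const (X w))).hasDerivWithinAt)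
      (fun s hs => by simpa using hspeed s (Set.Ico_subset_Icc_self hs)) s hs
    rw [sub_zero, zero_smul, sub_zero, sub_right_comm] at h
    exact h.trans (by gcongr; exact hs.2)
  have h := norm_image_sub_le_of_norm_deriv_le_segment'
    (f := fun s => γ s - (s • (X w + A (γ 0 - w)) + (s ^ 2 / 2) • A (X w)))
    (f' := fun s => X (γ s) - ((X w + A (γ 0 - w)) + s • A (X w)))
    (C := η * R + ‖A‖ * ((‖A‖ + η) * R * t)) (fun s hs => ?_) (fun s hs => ?_) t hmem
  · rw [sub_zero] at h
    convert h using 2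
    simp only [zero_smul, ne_eq, OfNat.ofNat_ne_zero, not_false_eq_true, zero_pow, zero_div]
    abel
  · refine ((hγ s hs).sub (.add ?_ ?_)).hasDerivWithinAt
    · simpa using (hasDerivAt_id s).smul_const (X w + A (γ 0 - w))
    · simpa using ((hasDerivAt_pow 2 s).div_const 2).smul_const (A (X w))
  · have hs' := Set.Ico_subset_Icc_self hs
    have hsplit : X (γ s) - ((X w + A (γ 0 - w)) + s • A (X w)) =
        (X (γ s) - X w - A (γ s - w)) + A (γ s - γ 0 - s • X w) := by
      simp only [map_sub, map_smul]; abel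
    rw [hsplit]
    exact (norm_add_le _ _).trans (add_le_add (hη' s hs') (A.le_opNorm_of_le (hfirst s hs')))

theorem exists_integralCurve_norm_sub_le [CompleteSpace E] (hX : ContDiffAt ℝ 1 X w) {β : ℝ → E}
    (hβ : (fun t => β t - w) =O[𝓝[>] 0] fun t : ℝ => t) :
    ∃ Γ : ℝ → ℝ → E, ∃ C > 0, ∀ᶠ t in 𝓝[>] 0, Γ t 0 = β t ∧
      ∀ s ∈ Set.Icc 0 t, HasDerivAt (Γ t) (X (Γ t s)) s ∧ ‖Γ t s - w‖ ≤ C * t := by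
  have hid : Tendsto (fun t : ℝ => t) (𝓝[>] 0) (𝓝 0) := nhdsWithin_le_nhds
  have hβw : Tendsto β (𝓝[>] 0) (𝓝 w) := by
    simpa using (hβ.trans_tendsto hid).add_const w
  have htend : Tendsto (fun t => (t, β t)) (𝓝[>] 0) (𝓝[≥] 0 ×ˢ 𝓝 w) :=
    (tendsto_id.mono_right (nhdsWithin_mono _ Set.Ioi_subset_Ici_self)).prodMk hβw
  obtain ⟨Γ, hΓ⟩ := (htend.eventually (eventually_exists_integralCurve hX)).choice
  obtain ⟨C, hC, hβC⟩ := hβ.exists_pos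
  refine ⟨Γ, C + (‖X w‖ + 1), by positivity, ?_⟩
  filter_upwards [hΓ, hβC.bound, self_mem_nhdsWithin] with t ⟨h0, hΓt⟩ hβt (ht : 0 < t)
  refine ⟨h0, fun s hs => ⟨(hΓt s hs).1, ?_⟩⟩
  have hst : (‖X w‖ + 1) * s ≤ (‖X w‖ + 1) * t := by gcongr; exact hs.2
  rw [Real.norm_of_nonneg ht.le] at hβt
  linarith [norm_sub_le_norm_sub_add_norm_sub (Γ t s) (β t) w, (hΓt s hs).2]

theorem isLittleO_integralCurve_sub_taylor {A : E →L[ℝ] E} (hX : HasFDerivAt X A w)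
    {Γ : ℝ → ℝ → E} {C : ℝ} (hC : 0 < C)
    (hΓ : ∀ᶠ t in 𝓝[>] 0, ∀ s ∈ Set.Icc 0 t,
      HasDerivAt (Γ t) (X (Γ t s)) s ∧ ‖Γ t s - w‖ ≤ C * t) :
    (fun t => Γ t t - Γ t 0 - t • (X w + A (Γ t 0 - w)) - (t ^ 2 / 2) • A (X w))
      =o[𝓝[>] 0] fun t : ℝ => t ^ 2 := by
  refine Asymptotics.isLittleO_iff.2 fun c hc => ?_
  set η := c / (2 * C)
  obtain ⟨ρ, hρ, hXρ⟩ := Metric.nhds_basis_closedBall.mem_iff.1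
    (hX.isLittleO.def (show 0 < η by positivity))
  have hsmall : ∀ k ε : ℝ, 0 < ε → ∀ᶠ t in 𝓝[>] (0 : ℝ), k * t ≤ ε := fun k ε hε =>
    (((continuous_const_mul k).tendsto' 0 0 (mul_zero k)).mono_left
      nhdsWithin_le_nhds).eventually_le_const hε
  filter_upwards [hΓ, self_mem_nhdsWithin, hsmall C ρ hρ,
    hsmall (‖A‖ * (‖A‖ + η) * C) (c / 2) (half_pos hc)] with t hΓt (ht : 0 < t) htρ htc
  refine (norm_integralCurve_sub_taylor_le ht.le (by positivity) (fun s hs => (hΓt s hs).1)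
    (fun s hs => (hΓt s hs).2) fun s hs =>
      hXρ (mem_closedBall_iff_norm.2 ((hΓt s hs).2.trans htρ))).trans ?_
  have hηC : η * C = c / 2 := by simp only [η]; field_simp
  calc (η * (C * t) + ‖A‖ * ((‖A‖ + η) * (C * t) * t)) * t
      = (η * C + ‖A‖ * (‖A‖ + η) * C * t) * t ^ 2 := by ring
    _ ≤ (c / 2 + c / 2) * t ^ 2 := by rw [hηC]; gcongr
    _ = c * ‖t ^ 2‖ := by rw [add_halves, Real.norm_of_nonneg (by positivity)]

end IntegralCurves

section Invariance

variable {E : Type*} [NormedAddCommGroup E] [NormedSpace ℝ E] [FiniteDimensional ℝ E]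
  {Z : Set E} {w : E} {X : E → E}

theorem exists_eventually_inner_le_mul_infDist_sq (hZ : IsClosed Z) (hw : w ∈ Z)
    (hX : ContDiffAt ℝ 1 X w)
    (hXZ : ∀ᶠ z in 𝓝 w, z ∈ Z → ∀ ℓ, IsProximalNormal Z z ℓ → ℓ (X z) ≤ 0) :
    ∃ C, ∀ᶠ p in 𝓝 w, ∃ z ∈ Z,
      dist (toEuclidean p) (toEuclidean z) = Metric.infDist (toEuclidean p) (toEuclidean '' Z) ∧
      inner ℝ (toEuclidean (p - z)) (toEuclidean (X p)) ≤
        C * Metric.infDist (toEuclidean p) (toEuclidean '' Z) ^ 2 := by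
  obtain ⟨K, s, hs, hK⟩ := hX.exists_lipschitzOnWith
  set e := (toEuclidean (E := E)).toContinuousLinearMap
  set e' := (toEuclidean (E := E)).symm.toContinuousLinearMap
  refine ⟨‖e‖ * (K * ‖e'‖), ?_⟩
  filter_upwards [eventually_exists_nearest hZ hw (hXZ.and hs), hs]
    with p ⟨z, hz, ⟨htan, hzs⟩, hdist⟩ hps
  refine ⟨z, hz, hdist, ?_⟩
  have hnormal : inner ℝ (e (p - z)) (e (X z)) ≤ 0 :=
    htan hz _ (isProximalNormal_of_dist_eq_infDist hdist)
  have hpz : ‖p - z‖ ≤ ‖e'‖ * ‖e (p - z)‖ := by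
    simpa [e, e'] using e'.le_opNorm (e (p - z))
  have hlip : ‖e (X p - X z)‖ ≤ ‖e‖ * (K * (‖e'‖ * ‖e (p - z)‖)) :=
    (e.le_opNorm_of_le (hK.norm_sub_le hps hzs)).trans (by gcongr)
  calc inner ℝ (e (p - z)) (e (X p))
      = inner ℝ (e (p - z)) (e (X z)) + inner ℝ (e (p - z)) (e (X p - X z)) := by
        rw [← inner_add_right, ← map_add, add_sub_cancel]
    _ ≤ 0 + ‖e (p - z)‖ * (‖e‖ * (K * (‖e'‖ * ‖e (p - z)‖))) :=
        add_le_add hnormal ((real_inner_le_norm _ _).trans (by gcongr))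
    _ = ‖e‖ * (K * ‖e'‖) * ‖e (p - z)‖ ^ 2 := by ring
    _ = _ := by rw [← hdist, dist_eq_norm, ← map_sub]; rfl

theorem frequently_slope_infDist_sq_lt {γ : ℝ → E} {v z : E} {t r : ℝ} (hγ : HasDerivAt γ v t)
    (hz : z ∈ Z) (hdist : dist (toEuclidean (γ t)) (toEuclidean z) =
      Metric.infDist (toEuclidean (γ t)) (toEuclidean '' Z))
    (hr : 2 * inner ℝ (toEuclidean (γ t - z)) (toEuclidean v) < r) :
    ∃ᶠ s in 𝓝[>] t, (s - t)⁻¹ * (Metric.infDist (toEuclidean (γ s)) (toEuclidean '' Z) ^ 2 -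
      Metric.infDist (toEuclidean (γ t)) (toEuclidean '' Z) ^ 2) < r := by
  have hsq : HasDerivAt (fun s => ‖toEuclidean (γ s - z)‖ ^ 2)
      (2 * inner ℝ (toEuclidean (γ t - z)) (toEuclidean v)) t :=
    (toEuclidean.hasFDerivAt.comp_hasDerivAt t (hγ.sub_const z)).norm_sq
  have hslope := hsq.hasDerivWithinAt.limsup_slope_le' Set.self_notMem_Ioi hr
  refine (hslope.and self_mem_nhdsWithin).frequently.mono fun s ⟨hs, hts⟩ => hs.trans_le' ?_
  rw [slope_def_module, smul_eq_mul, ← hdist, dist_eq_norm, ← map_sub]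
  refine mul_le_mul_of_nonneg_left (sub_le_sub_right ?_ _) (inv_nonneg.2 (sub_nonneg.2 hts.le))
  rw [map_sub, ← dist_eq_norm]
  gcongr
  · exact Metric.infDist_nonneg
  · exact Metric.infDist_le_dist_of_mem (Set.mem_image_of_mem _ hz)

theorem exists_mem_nhds_forall_integralCurve_mem (hZ : IsClosed Z) (hw : w ∈ Z)
    (hX : ContDiffAt ℝ 1 X w)
    (hXZ : ∀ᶠ z in 𝓝 w, z ∈ Z → ∀ ℓ, IsProximalNormal Z z ℓ → ℓ (X z) ≤ 0) :
    ∃ U ∈ 𝓝 w, ∀ (γ : ℝ → E) (T : ℝ), γ 0 ∈ Z →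
      (∀ t ∈ Set.Icc 0 T, HasDerivAt γ (X (γ t)) t ∧ γ t ∈ U) → ∀ t ∈ Set.Icc 0 T, γ t ∈ Z := by
  obtain ⟨C, hC⟩ := exists_eventually_inner_le_mul_infDist_sq hZ hw hX hXZ
  refine ⟨_, hC, fun γ T hγ0 hγ => ?_⟩
  set f : ℝ → ℝ := fun t => Metric.infDist (toEuclidean (γ t)) (toEuclidean '' Z) ^ 2
  have hcont : ContinuousOn f (Set.Icc 0 T) := fun t ht => by
    have := (hγ t ht).1.continuousAt
    exact ContinuousAt.continuousWithinAt (by fun_prop)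
  have hslope : ∀ t ∈ Set.Ico 0 T, ∀ r, 2 * C * f t < r →
      ∃ᶠ s in 𝓝[>] t, (s - t)⁻¹ * (f s - f t) < r := fun t ht r hr => by
    obtain ⟨hderiv, z, hz, hdist, hle⟩ := hγ t (Set.Ico_subset_Icc_self ht)
    exact frequently_slope_infDist_sq_lt hderiv hz hdist (by simp only [f] at hr; linarith)
  have hzero : f 0 = 0 := by simp [f, Metric.infDist_zero_of_mem (Set.mem_image_of_mem _ hγ0)]
  intro t ht
  have hft : f t ≤ 0 := by
    simpa [gronwallBound_ε0] using le_gronwallBound_of_liminf_deriv_right_le (ε := 0) hcont hslope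
      hzero.le (fun t _ => (add_zero _).ge) t ht
  have hclosed : IsClosed (toEuclidean '' Z) := toEuclidean.toHomeomorph.isClosed_image.2 hZ
  have := (hclosed.mem_iff_infDist_zero ⟨_, Set.mem_image_of_mem _ hγ0⟩).2
    (pow_eq_zero_iff two_ne_zero |>.1 (hft.antisymm (sq_nonneg _)))
  exact toEuclidean.injective.mem_set_image.1 this

theorem exists_curve_step (hZ : IsClosed Z) (hw : w ∈ Z) (hX : ContDiffAt ℝ 1 X w)
    (hXZ : ∀ᶠ z in 𝓝 w, z ∈ Z → ∀ ℓ, IsProximalNormal Z z ℓ → ℓ (X z) ≤ 0)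
    {β : ℝ → E} {a b : E} (hβZ : ∀ᶠ t in 𝓝[>] 0, β t ∈ Z)
    (hβ : (fun t => β t - w - t • a - t ^ 2 • b) =o[𝓝[>] 0] fun t : ℝ => t ^ 2) :
    ∃ β' : ℝ → E, (∀ᶠ t in 𝓝[>] 0, β' t ∈ Z) ∧
      (fun t => β' t - w - t • (a + X w) -
        t ^ 2 • (b + fderiv ℝ X w a + (2⁻¹ : ℝ) • fderiv ℝ X w (X w))) =o[𝓝[>] 0]
        fun t : ℝ => t ^ 2 := by
  have := FiniteDimensional.complete ℝ E
  set A := fderiv ℝ X w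
  have hsq : (fun t : ℝ => t ^ 2) =o[𝓝[>] 0] fun t : ℝ => t :=
    (Asymptotics.isLittleO_pow_id one_lt_two).mono nhdsWithin_le_nhds
  have hsmul (g : ℝ → ℝ) (v : E) : (fun t => g t • v) =O[𝓝[>] 0] g :=
    Asymptotics.IsBigO.of_bound ‖v‖ (.of_forall fun t => by rw [norm_smul, mul_comm])
  have hβ₁ : (fun t => β t - w - t • a) =o[𝓝[>] 0] fun t : ℝ => t := by
    simpa using (hβ.trans hsq).add ((hsmul (· ^ 2) b).trans_isLittleO hsq)
  have hβ₀ : (fun t => β t - w) =O[𝓝[>] 0] fun t : ℝ => t := by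
    simpa using hβ₁.isBigO.add (hsmul (·) a)
  obtain ⟨U, hU, hinv⟩ := exists_mem_nhds_forall_integralCurve_mem hZ hw hX hXZ
  obtain ⟨r, hr, hball⟩ := Metric.nhds_basis_closedBall.mem_iff.1 hU
  obtain ⟨Γ, C, hC, hΓ⟩ := exists_integralCurve_norm_sub_le hX hβ₀
  have hCr : ∀ᶠ t in 𝓝[>] (0 : ℝ), C * t ≤ r :=
    ((continuous_const_mul C).tendsto' 0 0 (mul_zero C)).mono_left
      nhdsWithin_le_nhds |>.eventually_le_const hr
  refine ⟨fun t => Γ t t, ?_, ?_⟩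
  · filter_upwards [hβZ, hΓ, hCr, self_mem_nhdsWithin] with t htZ ⟨h0, hΓt⟩ htr (ht : 0 < t)
    exact hinv (Γ t) t (h0 ▸ htZ) (fun s hs => ⟨(hΓt s hs).1,
      hball (mem_closedBall_iff_norm.2 ((hΓt s hs).2.trans htr))⟩) t ⟨ht.le, le_rfl⟩
  · have hdrift : (fun t => t • A (β t - w - t • a)) =o[𝓝[>] 0] fun t : ℝ => t ^ 2 := by
      simpa [sq] using (Asymptotics.isBigO_refl (fun t : ℝ => t) _).smul_isLittleO
        (A.isBigO_comp _ _ |>.trans_isLittleO hβ₁)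
    have hsum := ((isLittleO_integralCurve_sub_taylor (A := A)
      (hX.differentiableAt one_ne_zero).hasFDerivAt hC
      (hΓ.mono fun t ht => ht.2)).add hβ).add hdrift
    refine hsum.congr' ?_ .rfl
    filter_upwards [hΓ] with t ht
    rw [ht.1]
    simp only [map_sub, map_smul]
    module

theorem IsProximalNormal.lieBracket_nonpos {Y : E → E} (hZ : IsClosed Z) (hw : w ∈ Z)
    (hX : ContDiffAt ℝ 1 X w) (hY : ContDiffAt ℝ 1 Y w)
    (hXZ : ∀ᶠ z in 𝓝 w, z ∈ Z → ∀ ℓ, IsProximalNormal Z z ℓ → ℓ (X z) = 0)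
    (hYZ : ∀ᶠ z in 𝓝 w, z ∈ Z → ∀ ℓ, IsProximalNormal Z z ℓ → ℓ (Y z) = 0)
    {ℓ : E →L[ℝ] ℝ} (hℓ : IsProximalNormal Z w ℓ) : ℓ (VectorField.lieBracket ℝ X Y w) ≤ 0 := by
  have hpos : ∀ {W : E → E}, (∀ᶠ z in 𝓝 w, z ∈ Z → ∀ ℓ, IsProximalNormal Z z ℓ → ℓ (W z) = 0) →
      ∀ᶠ z in 𝓝 w, z ∈ Z → ∀ ℓ, IsProximalNormal Z z ℓ → ℓ (W z) ≤ 0 := fun hW =>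
    hW.mono fun z hz hzZ ℓ hℓ => (hz hzZ ℓ hℓ).le
  have hneg : ∀ {W : E → E}, (∀ᶠ z in 𝓝 w, z ∈ Z → ∀ ℓ, IsProximalNormal Z z ℓ → ℓ (W z) = 0) →
      ∀ᶠ z in 𝓝 w, z ∈ Z → ∀ ℓ, IsProximalNormal Z z ℓ → ℓ ((-W) z) ≤ 0 := fun hW =>
    hpos (hW.mono fun z hz hzZ ℓ hℓ => by simp [hz hzZ ℓ hℓ])
  obtain ⟨β₁, hβ₁Z, hβ₁⟩ := exists_curve_step hZ hw hX (hpos hXZ) (β := fun _ => w) (a := 0)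
    (b := 0) (Eventually.of_forall fun _ => hw) (by simp)
  obtain ⟨β₂, hβ₂Z, hβ₂⟩ := exists_curve_step hZ hw hY (hpos hYZ) hβ₁Z hβ₁
  obtain ⟨β₃, hβ₃Z, hβ₃⟩ := exists_curve_step hZ hw hX.neg (hneg hXZ) hβ₂Z hβ₂
  obtain ⟨β₄, hβ₄Z, hβ₄⟩ := exists_curve_step hZ hw hY.neg (hneg hYZ) hβ₃Z hβ₃
  refine hℓ.apply_nonpos_of_isLittleO hβ₄Z (g := fun t => t ^ 2) ?_ (hβ₄.congr_left fun t => ?_)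
  · refine tendsto_nhdsWithin_iff.2 ⟨(Continuous.tendsto' (by fun_prop) _ _ (by simp)).mono_left
      nhdsWithin_le_nhds, ?_⟩
    filter_upwards [self_mem_nhdsWithin] with t (ht : 0 < t)
    exact pow_pos ht 2
  · simp only [fderiv_fun_neg, VectorField.lieBracket, map_add, map_neg, map_zero,
      neg_apply]
    module

theorem IsProximalNormal.lieBracket_eq_zero {Y : E → E} (hZ : IsClosed Z) (hw : w ∈ Z)
    (hX : ContDiffAt ℝ 1 X w) (hY : ContDiffAt ℝ 1 Y w)
    (hXZ : ∀ᶠ z in 𝓝 w, z ∈ Z → ∀ ℓ, IsProximalNormal Z z ℓ → ℓ (X z) = 0)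
    (hYZ : ∀ᶠ z in 𝓝 w, z ∈ Z → ∀ ℓ, IsProximalNormal Z z ℓ → ℓ (Y z) = 0)
    {ℓ : E →L[ℝ] ℝ} (hℓ : IsProximalNormal Z w ℓ) : ℓ (VectorField.lieBracket ℝ X Y w) = 0 := by
  refine (hℓ.lieBracket_nonpos hZ hw hX hY hXZ hYZ).antisymm ?_
  have h := hℓ.lieBracket_nonpos hZ hw hY hX hYZ hXZ
  rwa [VectorField.lieBracket_swap, map_neg, neg_nonpos] at h

theorem eventually_forall_eq_zero_of_continuousAt {ι : Type*} {V : ι → E → E}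
    (hV : ∀ i, ContinuousAt (V i) w)
    (hspan : ∀ ℓ : E →L[ℝ] ℝ, (∀ i, ℓ (V i w) = 0) → ℓ = 0) :
    ∀ᶠ z in 𝓝 w, ∀ ℓ : E →L[ℝ] ℝ, (∀ i, ℓ (V i z) = 0) → ℓ = 0 := by
  have hsphere : ∀ᶠ z in 𝓝 w, ∀ ℓ ∈ Metric.sphere (0 : E →L[ℝ] ℝ) 1, ∃ i, ℓ (V i z) ≠ 0 := by
    refine (isCompact_sphere _ _).eventually_forall_of_forall_eventually fun ℓ hℓ => ?_
    obtain ⟨i, hi⟩ : ∃ i, ℓ (V i w) ≠ 0 := by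
      by_contra! h
      exact Metric.ne_of_mem_sphere hℓ one_ne_zero (hspan ℓ h)
    have hcont : ContinuousAt (fun q : E × (E →L[ℝ] ℝ) => q.2 (V i q.1)) (w, ℓ) :=
      continuousAt_snd.clm_apply ((hV i).comp (x := (w, ℓ)) continuousAt_fst)
    exact (hcont.eventually_ne hi).mono fun q hq => ⟨i, hq⟩
  filter_upwards [hsphere] with z hz ℓ hℓ
  by_contra hne
  obtain ⟨i, hi⟩ := hz (‖ℓ‖⁻¹ • ℓ) (by simp [norm_smul, hne])
  exact hi (by simp [hℓ i])

theorem mem_nhds_of_forall_isProximalNormal_lieBracket {κ : Type*} [Finite κ] {X : κ → E → E}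
    (hZ : IsClosed Z) (hw : w ∈ Z) (hX : ∀ k, ContDiffAt ℝ 1 (X k) w)
    (hXZ : ∀ᶠ z in 𝓝 w, z ∈ Z → ∀ ℓ, IsProximalNormal Z z ℓ → ∀ k, ℓ (X k z) = 0)
    (hspan : ∀ ℓ : E →L[ℝ] ℝ, (∀ k, ℓ (X k w) = 0) →
      (∀ k l, ℓ (VectorField.lieBracket ℝ (X k) (X l) w) = 0) → ℓ = 0) : Z ∈ 𝓝 w := by
  have := FiniteDimensional.complete ℝ E
  set V : κ ⊕ κ × κ → E → E := Sum.elim X fun q => VectorField.lieBracket ℝ (X q.1) (X q.2)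
  have hV : ∀ i, ContinuousAt (V i) w
    | .inl k => (hX k).continuousAt
    | .inr q => ((hX q.1).lieBracket_vectorField (hX q.2) (m := 0) (by simp)).continuousAt
  have hVspan := eventually_forall_eq_zero_of_continuousAt hV fun ℓ hℓ =>
    hspan ℓ (fun k => hℓ (.inl k)) fun k l => hℓ (.inr (k, l))
  refine mem_nhds_of_eventually_isProximalNormal_eq_zero hZ hw ?_
  filter_upwards [hVspan, eventually_all.2 fun k => (hX k).eventually (by simp),
    hXZ.eventually_nhds] with z hz hXz hXZz hzZ ℓ hℓ
  have htangent (k : κ) : ∀ᶠ x in 𝓝 z, x ∈ Z → ∀ ℓ, IsProximalNormal Z x ℓ → ℓ (X k x) = 0 :=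
    hXZz.mono fun x hx hxZ ℓ hℓ => hx hxZ ℓ hℓ k
  exact hz ℓ fun
    | .inl k => (htangent k).self_of_nhds hzZ ℓ hℓ
    | .inr q => hℓ.lieBracket_eq_zero hZ hzZ (hXz q.1) (hXz q.2) (htangent q.1) (htangent q.2)

end Invariance

/-! ### Comparison for degenerate elliptic operators -/

section CurvatureOperator

variable {κ : Type*} [Fintype κ] {p : ℝ} {v : κ → ℝ}

/-- The degenerate elliptic operator `|v|^{p-1} (tr C + (p - 1) C (v, v) / |v|²)`, which is the
divergence of `ν_p` when `v` and `C` are the derivatives of first and second order of `φ` along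
the horizontal frame. -/
def curvOp (p : ℝ) (v : κ → ℝ) (C : κ → κ → ℝ) : ℝ :=
  (∑ k, v k ^ 2) ^ ((p - 1) / 2) * ∑ k, C k k +
    (p - 1) * (∑ k, v k ^ 2) ^ ((p - 3) / 2) * ∑ k, ∑ l, v k * C k l * v l

theorem sum_sq_pos (hv : v ≠ 0) : 0 < ∑ k, v k ^ 2 := by
  obtain ⟨k, hk⟩ := Function.ne_iff.1 hv
  exact Finset.sum_pos' (fun _ _ => sq_nonneg _) ⟨k, Finset.mem_univ k, sq_pos_of_ne_zero hk⟩

theorem contDiffAt_curvOp (p : ℝ) (hv : v ≠ 0) (C : κ → κ → ℝ) :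
    ContDiffAt ℝ ∞ (fun q : (κ → ℝ) × (κ → κ → ℝ) => curvOp p q.1 q.2) (v, C) := by
  have hS : ContDiffAt ℝ ∞ (fun q : (κ → ℝ) × (κ → κ → ℝ) => ∑ k, q.1 k ^ 2) (v, C) := by fun_prop
  have hpow : ∀ r : ℝ, ContDiffAt ℝ ∞
      (fun q : (κ → ℝ) × (κ → κ → ℝ) => (∑ k, q.1 k ^ 2) ^ r) (v, C) := fun r =>
    hS.rpow_const_of_ne (sum_sq_pos hv).ne'
  exact ((hpow _).mul (by fun_prop)).add ((contDiffAt_const.mul (hpow _)).mul (by fun_prop))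

theorem curvOp_add_smul (p : ℝ) (v : κ → ℝ) (C C' : κ → κ → ℝ) (c : ℝ) :
    curvOp p v (C + c • C') = curvOp p v C + c * curvOp p v C' := by
  have htr : ∑ k, c * C' k k = c * ∑ k, C' k k := by rw [Finset.mul_sum]
  have hquad : ∑ k, ∑ l, v k * (c * C' k l) * v l = c * ∑ k, ∑ l, v k * C' k l * v l := by
    simp only [Finset.mul_sum]
    exact Finset.sum_congr rfl fun k _ => Finset.sum_congr rfl fun l _ => by ring
  simp only [curvOp, Pi.add_apply, Pi.smul_apply, smul_eq_mul, mul_add, add_mul,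
    Finset.sum_add_distrib, htr, hquad]
  ring

theorem sum_sq_mul_trace_sub (v : κ → ℝ) (C : κ → κ → ℝ) :
    (∑ k, v k ^ 2) * ∑ k, C k k - ∑ k, ∑ l, v k * C k l * v l =
      (1 / 2) * ∑ k, ∑ l, (v l ^ 2 * C k k - v l * v k * C k l - v k * v l * C l k
        + v k ^ 2 * C l l) := by
  have h1 : ∑ k, ∑ l, v l ^ 2 * C k k = (∑ k, v k ^ 2) * ∑ k, C k k := by
    rw [Finset.sum_mul_sum, Finset.sum_comm]
  have h2 : ∑ k, ∑ l, v k ^ 2 * C l l = (∑ k, v k ^ 2) * ∑ k, C k k := by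
    rw [Finset.sum_mul_sum]
  have h3 : ∑ k, ∑ l, v l * v k * C k l = ∑ k, ∑ l, v k * C k l * v l :=
    Finset.sum_congr rfl fun k _ => Finset.sum_congr rfl fun l _ => by ring
  have h4 : ∑ k, ∑ l, v k * v l * C l k = ∑ k, ∑ l, v k * C k l * v l := by
    rw [Finset.sum_comm]
    exact Finset.sum_congr rfl fun k _ => Finset.sum_congr rfl fun l _ => by ring
  simp only [Finset.sum_add_distrib, Finset.sum_sub_distrib, h1, h2, h3, h4]
  ring

theorem curvOp_eq (p : ℝ) (hv : v ≠ 0) (C : κ → κ → ℝ) :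
    curvOp p v C = (∑ k, v k ^ 2) ^ ((p - 3) / 2) *
      ((1 / 2) * ∑ k, ∑ l, (v l ^ 2 * C k k - v l * v k * C k l - v k * v l * C l k
        + v k ^ 2 * C l l) + p * ∑ k, ∑ l, v k * C k l * v l) := by
  have hexp : (p - 1) / 2 = (p - 3) / 2 + 1 := by ring
  rw [← sum_sq_mul_trace_sub, curvOp, hexp, Real.rpow_add_one (sum_sq_pos hv).ne']
  ring

theorem curvOp_nonneg (hp : 0 ≤ p) (hv : v ≠ 0) {C : κ → κ → ℝ}
    (hC : ∀ ξ : κ → ℝ, 0 ≤ ∑ k, ∑ l, ξ k * C k l * ξ l) : 0 ≤ curvOp p v C := by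
  classical
  have hpair : ∀ (c d : ℝ) (k l : κ), ∑ a, ∑ b, (c • (Pi.single k 1 : κ → ℝ)) a * C a b *
      (d • (Pi.single l 1 : κ → ℝ)) b = c * d * C k l := fun c d k l => by
    rw [Finset.sum_eq_single k, Finset.sum_eq_single l]
    · simp only [Pi.smul_apply, Pi.single_eq_same, smul_eq_mul]; ring
    · intro b _ hb; simp [hb]
    · simp
    · intro a _ ha; simp [ha]
    · simp
  have hsub : ∀ ξ η : κ → ℝ, ∑ a, ∑ b, (ξ - η) a * C a b * (ξ - η) b =
      ∑ a, ∑ b, ξ a * C a b * ξ b - ∑ a, ∑ b, ξ a * C a b * η b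
      - ∑ a, ∑ b, η a * C a b * ξ b + ∑ a, ∑ b, η a * C a b * η b := fun ξ η => by
    simp only [← Finset.sum_sub_distrib, ← Finset.sum_add_distrib, Pi.sub_apply]
    exact Finset.sum_congr rfl fun a _ => Finset.sum_congr rfl fun b _ => by ring
  have hterm : ∀ k l, 0 ≤ v l ^ 2 * C k k - v l * v k * C k l - v k * v l * C l k
      + v k ^ 2 * C l l := fun k l => by
    have h := hC (v l • Pi.single k 1 - v k • Pi.single l 1)
    rw [hsub, hpair, hpair, hpair, hpair] at h
    linarith
  rw [curvOp_eq p hv]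
  exact mul_nonneg (Real.rpow_nonneg (sum_sq_pos hv).le _) (add_nonneg
    (mul_nonneg (by norm_num) (Finset.sum_nonneg fun k _ => Finset.sum_nonneg fun l _ => hterm k l))
    (mul_nonneg hp (hC v)))

theorem curvOp_rankOne (hv : v ≠ 0) (b : κ → ℝ) :
    curvOp p v (fun k l => b k * b l) = (∑ k, v k ^ 2) ^ ((p - 3) / 2) *
      ((1 / 2) * ∑ k, ∑ l, (v l * b k - v k * b l) ^ 2 + p * (∑ k, v k * b k) ^ 2) := by
  have h1 : ∑ k, ∑ l, (v l ^ 2 * (b k * b k) - v l * v k * (b k * b l) - v k * v l * (b l * b k)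
      + v k ^ 2 * (b l * b l)) = ∑ k, ∑ l, (v l * b k - v k * b l) ^ 2 :=
    Finset.sum_congr rfl fun k _ => Finset.sum_congr rfl fun l _ => by ring
  have h2 : ∑ k, ∑ l, v k * (b k * b l) * v l = (∑ k, v k * b k) ^ 2 := by
    rw [sq, Finset.sum_mul_sum]
    exact Finset.sum_congr rfl fun k _ => Finset.sum_congr rfl fun l _ => by ring
  rw [curvOp_eq p hv, h1, h2]

theorem parallel_of_curvOp_rankOne_nonpos (hp : 0 ≤ p) (hv : v ≠ 0) {b : κ → ℝ}
    (h : curvOp p v (fun k l => b k * b l) ≤ 0) (k l : κ) : v l * b k = v k * b l := by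
  have hnonneg : ∀ k, 0 ≤ ∑ l, (v l * b k - v k * b l) ^ 2 := fun k =>
    Finset.sum_nonneg fun _ _ => sq_nonneg _
  have hsum : ∑ k, ∑ l, (v l * b k - v k * b l) ^ 2 = 0 := by
    rw [curvOp_rankOne hv] at h
    have h1 := nonpos_of_mul_nonpos_right h (Real.rpow_pos_of_pos (sum_sq_pos hv) _)
    have h2 : 0 ≤ p * (∑ k, v k * b k) ^ 2 := by positivity
    exact le_antisymm (by linarith) (Finset.sum_nonneg fun k _ => hnonneg k)
  have hk := (Finset.sum_eq_zero_iff_of_nonneg fun k _ => hnonneg k).1 hsum k (Finset.mem_univ k)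
  have hkl := (Finset.sum_eq_zero_iff_of_nonneg fun _ _ => sq_nonneg _).1 hk l (Finset.mem_univ l)
  exact sub_eq_zero.1 (sq_eq_zero_iff.1 hkl)

end CurvatureOperator

section Jets

variable {E κ : Type*} [NormedAddCommGroup E] [NormedSpace ℝ E] {Y : κ → E → E} {u ψ : E → ℝ}
  {x : E}

/-- The derivatives of `u` along the vector fields `Y k`. -/
def hGrad (Y : κ → E → E) (u : E → ℝ) (x : E) (k : κ) : ℝ := fderiv ℝ u x (Y k x)

/-- The second derivatives `Y k (Y l u)`. -/
def hHess (Y : κ → E → E) (u : E → ℝ) (x : E) (k l : κ) : ℝ :=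
  fderiv ℝ (fun y => hGrad Y u y l) x (Y k x)

/-- The first and second derivatives of `u` along the vector fields `Y k`: the arguments of a
second order operator. -/
def jet (Y : κ → E → E) (u : E → ℝ) (x : E) : (κ → ℝ) × (κ → κ → ℝ) :=
  (hGrad Y u x, hHess Y u x)

theorem hGrad_eq_zero (h : fderiv ℝ u x = 0) : hGrad Y u x = 0 := by
  funext k
  simp [hGrad, h]

theorem hGrad_congr (h : u =ᶠ[𝓝 x] ψ) : hGrad Y u x = hGrad Y ψ x := by
  unfold hGrad
  rw [h.fderiv_eq]

theorem hHess_congr (h : u =ᶠ[𝓝 x] ψ) : hHess Y u x = hHess Y ψ x := by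
  funext k l
  have hgrad : (fun y => hGrad Y u y l) =ᶠ[𝓝 x] fun y => hGrad Y ψ y l := by
    filter_upwards [h.eventuallyEq_nhds] with y hy using congrFun (hGrad_congr hy) l
  rw [hHess, hgrad.fderiv_eq, hHess]

theorem differentiableAt_fderiv_of_contDiffAt_two (hu : ContDiffAt ℝ 2 u x) :
    DifferentiableAt ℝ (fderiv ℝ u) x :=
  (hu.fderiv_right (m := 1) (by norm_num)).differentiableAt one_ne_zero

theorem hHess_eq (hu : ContDiffAt ℝ 2 u x) (k : κ) {l : κ} (hY : DifferentiableAt ℝ (Y l) x) :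
    hHess Y u x k l = fderiv ℝ (fderiv ℝ u) x (Y k x) (Y l x) +
      fderiv ℝ u x (fderiv ℝ (Y l) x (Y k x)) := by
  have h := (differentiableAt_fderiv_of_contDiffAt_two hu).hasFDerivAt.clm_apply hY.hasFDerivAt
  simp only [hHess, hGrad]
  rw [h.fderiv]
  simp [add_comm]

theorem hHess_comm_of_fderiv_eq_zero (hu : ContDiffAt ℝ 2 u x)
    (hY : ∀ k, DifferentiableAt ℝ (Y k) x) (h : fderiv ℝ u x = 0) (k l : κ) :
    hHess Y u x k l = hHess Y u x l k := by
  rw [hHess_eq hu k (hY l), hHess_eq hu l (hY k), h]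
  simpa using hu.isSymmSndFDerivAt (by simp) (Y k x) (Y l x)

theorem continuousAt_jet [Finite κ] (hY : ∀ k, ContDiffAt ℝ 1 (Y k) x) (hu : ContDiffAt ℝ 2 u x) :
    ContinuousAt (jet Y u) x := by
  cases nonempty_fintype κ
  have hgrad : ∀ k, ContDiffAt ℝ 1 (fun y => hGrad Y u y k) x := fun k =>
    (hu.fderiv_right (m := 1) (by norm_num)).clm_apply (hY k)
  exact (continuousAt_pi.2 fun k => (hgrad k).continuousAt).prodMk <| continuousAt_pi.2 fun k =>
    continuousAt_pi.2 fun l => (((hgrad l).fderiv_right (m := 0) le_rfl).clm_apply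
      ((hY k).of_le zero_le_one)).continuousAt

theorem jet_add_smul (hY : ∀ k, DifferentiableAt ℝ (Y k) x) (hu : ContDiffAt ℝ 2 u x)
    (hψ : ContDiffAt ℝ 2 ψ x) (c : ℝ) :
    jet Y (u + c • ψ) x = jet Y u x + c • jet Y ψ x := by
  have hsum : ContDiffAt ℝ 2 (u + c • ψ) x := hu.add (contDiffAt_const.smul hψ)
  have hev : fderiv ℝ (u + c • ψ) =ᶠ[𝓝 x] fderiv ℝ u + c • fderiv ℝ ψ := by
    filter_upwards [hu.eventually (by simp), hψ.eventually (by simp)] with y hy hy'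
    have hd := hy'.differentiableAt two_ne_zero
    rw [fderiv_add (hy.differentiableAt two_ne_zero) (hd.const_smul c), fderiv_const_smul hd]
    rfl
  have hd := differentiableAt_fderiv_of_contDiffAt_two hψ
  refine Prod.ext (funext fun k => ?_) (funext fun k => funext fun l => ?_)
  · simp [jet, hGrad, hev.self_of_nhds]
  · simp only [jet, hHess_eq hsum k (hY l), hHess_eq hu k (hY l), hHess_eq hψ k (hY l),
      hev.self_of_nhds, hev.fderiv_eq, Prod.snd_add, Prod.smul_snd, Pi.add_apply, Pi.smul_apply]
    rw [fderiv_add (differentiableAt_fderiv_of_contDiffAt_two hu) (hd.const_smul c),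
      fderiv_const_smul hd]
    simp only [add_apply, smul_apply, smul_eq_mul]
    ring

theorem jet_sub_const_sq (hY : ∀ k, DifferentiableAt ℝ (Y k) x) (hu : ContDiffAt ℝ 2 u x) :
    jet Y (fun y => (u y - u x) ^ 2) x =
      (2 : ℝ) • ((0 : κ → ℝ), fun k l => hGrad Y u x k * hGrad Y u x l) := by
  have hgrad : ∀ l, (fun y => hGrad Y (fun y => (u y - u x) ^ 2) y l) =ᶠ[𝓝 x]
      fun y => 2 * (u y - u x) * hGrad Y u y l := fun l => by
    filter_upwards [hu.eventually (by simp)] with y hy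
    have h := ((hy.differentiableAt two_ne_zero).hasFDerivAt.sub_const (u x)).pow 2
    simp [hGrad, h.fderiv]
  have hu' : DifferentiableAt ℝ (fun y => 2 * (u y - u x)) x :=
    ((hu.differentiableAt two_ne_zero).sub_const _).const_mul 2
  refine Prod.ext (funext fun k => ?_) (funext fun k => funext fun l => ?_)
  · simpa [jet] using (hgrad k).self_of_nhds
  · have hl : DifferentiableAt ℝ (fun y => hGrad Y u y l) x :=
      (differentiableAt_fderiv_of_contDiffAt_two hu).clm_apply (hY l)
    simp only [jet, hHess]
    rw [(hgrad l).fderiv_eq, fderiv_fun_mul hu' hl, fderiv_const_mul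
      ((hu.differentiableAt two_ne_zero).sub_const _), fderiv_sub_const]
    simp only [sub_self, mul_zero, zero_smul, zero_add, smul_apply, smul_eq_mul, Prod.smul_mk,
      Pi.smul_apply, hGrad]
    ring

theorem deriv_deriv_nonneg_of_isLocalMin {f : ℝ → ℝ} {a : ℝ} (hf : ContinuousAt f a)
    (hmin : IsLocalMin f a) : 0 ≤ deriv (deriv f) a := by
  by_contra! hneg
  have hmax : IsLocalMax f a := isLocalMax_of_deriv_deriv_neg hneg hmin.deriv_eq_zero hf
  have hconst : f =ᶠ[𝓝 a] fun _ => f a := by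
    filter_upwards [hmin, hmax] with t h1 h2 using le_antisymm h2 h1
  have hderiv : deriv f =ᶠ[𝓝 a] fun _ => 0 := by
    filter_upwards [hconst.eventuallyEq_nhds] with t ht
    rw [ht.deriv_eq, deriv_const]
  rw [hderiv.deriv_eq, deriv_const] at hneg
  exact hneg.false

theorem fderiv_fderiv_nonneg_of_isLocalMin (hu : ContDiffAt ℝ 2 u x) (hmin : IsLocalMin u x)
    (v : E) : 0 ≤ fderiv ℝ (fderiv ℝ u) x v v := by
  have hline : ∀ t : ℝ, HasDerivAt (fun t : ℝ => x + t • v) v t := fun t => by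
    simpa using ((hasDerivAt_id t).smul_const v).const_add x
  have hline0 : Tendsto (fun t : ℝ => x + t • v) (𝓝 0) (𝓝 x) := by
    simpa using (hline 0).continuousAt.tendsto
  have hderiv : deriv (fun t : ℝ => u (x + t • v)) =ᶠ[𝓝 0] fun t => fderiv ℝ u (x + t • v) v := by
    filter_upwards [hline0.eventually (hu.eventually (by simp))] with t ht
    exact ((ht.differentiableAt two_ne_zero).hasFDerivAt.comp_hasDerivAt t (hline t)).deriv
  have hsecond : deriv (fun t : ℝ => fderiv ℝ u (x + t • v) v) 0 =
      fderiv ℝ (fderiv ℝ u) x v v := by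
    have h0 : HasFDerivAt (fderiv ℝ u) (fderiv ℝ (fderiv ℝ u) x) (x + (0 : ℝ) • v) := by
      simpa using (differentiableAt_fderiv_of_contDiffAt_two hu).hasFDerivAt
    have h1 := h0.comp_hasDerivAt (0 : ℝ) (hline 0)
    exact (h1.clm_apply (hasDerivAt_const (0 : ℝ) v)).deriv.trans (by simp)
  rw [← hsecond, ← hderiv.deriv_eq]
  refine deriv_deriv_nonneg_of_isLocalMin ?_ ?_
  · exact ContinuousAt.comp (g := u) (by simpa using hu.continuousAt) (hline 0).continuousAt
  · filter_upwards [hline0.eventually hmin] with t ht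
    simpa using ht

theorem hHess_nonneg_of_isLocalMin [Fintype κ] (hY : ∀ k, DifferentiableAt ℝ (Y k) x)
    (hu : ContDiffAt ℝ 2 u x) (hmin : IsLocalMin u x) (ξ : κ → ℝ) :
    0 ≤ ∑ k, ∑ l, ξ k * hHess Y u x k l * ξ l := by
  refine (fderiv_fderiv_nonneg_of_isLocalMin hu hmin (∑ k, ξ k • Y k x)).trans_eq ?_
  simp only [map_sum, map_smul, sum_apply, smul_apply, smul_eq_mul, Finset.mul_sum,
    fun k l => hHess_eq hu k (hY l), hmin.fderiv_eq_zero, zero_apply, add_zero]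
  rw [Finset.sum_comm]
  exact Finset.sum_congr rfl fun k _ => Finset.sum_congr rfl fun l _ => by ring

end Jets

section Comparison

variable {E : Type*} [NormedAddCommGroup E] [NormedSpace ℝ E]

theorem eventually_lt_add_smul_of_hasStrictFDerivAt {F : E → ℝ} {F' : E →L[ℝ] ℝ} {a b : E}
    (hF : HasStrictFDerivAt F F' a) (hb : 0 < F' b) :
    ∀ᶠ q : (E × E) × ℝ in 𝓝 ((a, b), 0), 0 < q.2 → F q.1.1 < F (q.1.1 + q.2 • q.1.2) := by
  have hc : 0 < F' b / (2 * (‖b‖ + 1)) := by positivity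
  have hnorm : ∀ᶠ q : (E × E) × ℝ in 𝓝 ((a, b), 0),
      F' b / (2 * (‖b‖ + 1)) * ‖q.1.2‖ < F' q.1.2 := by
    refine ContinuousAt.eventually_lt (by fun_prop) (by fun_prop) ?_
    dsimp only
    rw [div_mul_eq_mul_div, div_lt_iff₀ (by positivity)]
    nlinarith [norm_nonneg b]
  have hpair : Tendsto (fun q : (E × E) × ℝ => (q.1.1 + q.2 • q.1.2, q.1.1)) (𝓝 ((a, b), 0))
      (𝓝 (a, a)) := by
    have h : Continuous fun q : (E × E) × ℝ => (q.1.1 + q.2 • q.1.2, q.1.1) := by fun_prop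
    simpa using h.tendsto ((a, b), 0)
  filter_upwards [hpair.eventually (hF.isLittleO.def hc), hnorm] with q hq hqb hq0
  simp only [add_sub_cancel_left, map_smul, smul_eq_mul, norm_smul, Real.norm_eq_abs,
    abs_of_pos hq0] at hq
  nlinarith [(abs_le.1 hq).1, mul_lt_mul_of_pos_left hqb hq0]

theorem eventually_exists_isLocalMin_sub_mul {M : Type*} [MetricSpace M] [ProperSpace M]
    {d ψ : M → ℝ} {z : M} {P : M → Prop} (hP : ∀ᶠ x in 𝓝 z, P x)
    (hd : ∀ᶠ x in 𝓝 z, ContinuousAt d x) (hψ : ∀ᶠ x in 𝓝 z, ContinuousAt ψ x)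
    (hd0 : ∀ᶠ x in 𝓝 z, 0 ≤ d x) (hz : d z = 0)
    (hstrict : ∀ᶠ x in 𝓝 z, x ≠ z → d x = 0 → ψ x < ψ z) :
    ∀ᶠ ε in 𝓝[>] (0 : ℝ), ∃ x, P x ∧ IsLocalMin (fun y => d y - ε * ψ y) x := by
  obtain ⟨ρ, hρ, hball⟩ := Metric.nhds_basis_closedBall.eventually_iff.1
    (hP.and (hd.and (hψ.and (hd0.eventually_nhds.and hstrict))))
  have hsphere : ∀ᶠ ε in 𝓝 (0 : ℝ), ∀ x ∈ Metric.sphere z ρ, 0 < ε → ε * (ψ x - ψ z) < d x := by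
    refine (isCompact_sphere z ρ).eventually_forall_of_forall_eventually fun x hx => ?_
    obtain ⟨-, hdx, hψx, hd0x, hx'⟩ := hball (Metric.sphere_subset_closedBall hx)
    have hd' : ContinuousAt (fun q : ℝ × M => d q.2) (0, x) := hdx.comp continuousAt_snd
    have hψ' : ContinuousAt (fun q : ℝ × M => ψ q.2) (0, x) := hψx.comp continuousAt_snd
    rcases hd0x.self_of_nhds.lt_or_eq with hpos | hzero
    · have hmul : ContinuousAt (fun q : ℝ × M => q.1 * (ψ q.2 - ψ z)) (0, x) :=
        continuousAt_fst.mul (hψ'.sub continuousAt_const)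
      exact (hmul.eventually_lt hd' (by simpa using hpos)).mono fun q hq _ => hq
    · have hlt := hx' (Metric.ne_of_mem_sphere hx hρ.ne') hzero.symm
      filter_upwards [hψ'.eventually_lt continuousAt_const hlt,
        continuousAt_snd.eventually hd0x] with q hq hq0 hε
      exact (mul_neg_of_pos_of_neg hε (sub_neg.2 hq)).trans_le hq0
  filter_upwards [nhdsWithin_le_nhds hsphere, self_mem_nhdsWithin] with ε hε hε0
  obtain ⟨x, hx, hmin⟩ := Metric.exists_isLocalMin_mem_ball (f := fun y => d y - ε * ψ y)
    (fun y hy => ((hball hy).2.1.sub (continuousAt_const.mul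
      (hball hy).2.2.1)).continuousWithinAt) (Metric.mem_closedBall_self hρ.le) fun x hx => by
      have := hε x hx hε0
      rw [hz]
      linarith
  exact ⟨x, (hball (Metric.ball_subset_closedBall hx)).1, hmin⟩

variable {κ : Type*} [Fintype κ] {Y : κ → E → E} {u₁ u₂ Φ : E → ℝ} {x z : E}
  {F : (κ → ℝ) × (κ → κ → ℝ) → ℝ} {F' : ((κ → ℝ) × (κ → κ → ℝ)) →L[ℝ] ℝ}

theorem exists_jet_eq_of_isLocalMin (hY : ∀ k, DifferentiableAt ℝ (Y k) x)
    (hu₁ : ContDiffAt ℝ 2 u₁ x) (hu₂ : ContDiffAt ℝ 2 u₂ x) (hΦ : ContDiffAt ℝ 2 Φ x) {ε : ℝ}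
    (hmin : IsLocalMin (fun y => u₂ y - u₁ y - ε * Φ y) x) :
    ∃ B : κ → κ → ℝ, (∀ ξ : κ → ℝ, 0 ≤ ∑ k, ∑ l, ξ k * B k l * ξ l) ∧
      jet Y u₂ x = jet Y u₁ x + ε • jet Y Φ x + (0, B) := by
  have hsub : ContDiffAt ℝ 2 (u₂ + (-1 : ℝ) • u₁) x := hu₂.add (contDiffAt_const.smul hu₁)
  have heq : (fun y => u₂ y - u₁ y - ε * Φ y) = u₂ + (-1 : ℝ) • u₁ + (-ε) • Φ := by
    funext y
    simp only [Pi.add_apply, Pi.smul_apply, smul_eq_mul]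
    ring
  rw [heq] at hmin
  refine ⟨_, hHess_nonneg_of_isLocalMin hY (hsub.add (contDiffAt_const.smul hΦ)) hmin, ?_⟩
  have hjet := jet_add_smul hY hsub hΦ (-ε)
  rw [jet_add_smul hY hu₂ hu₁] at hjet
  rw [← hGrad_eq_zero hmin.fderiv_eq_zero]
  change _ = _ + jet Y (u₂ + (-1 : ℝ) • u₁ + (-ε) • Φ) x
  rw [hjet]
  module

/-- Degenerate ellipticity near `q` of a second order operator `F`, viewed as a function of the
first and second derivatives: `F` is monotone in the second derivatives. -/
def IsEllipticAt (F : (κ → ℝ) × (κ → κ → ℝ) → ℝ) (q : (κ → ℝ) × (κ → κ → ℝ)) : Prop :=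
  ∀ᶠ q' in 𝓝 q, ∀ B : κ → κ → ℝ, (∀ ξ : κ → ℝ, 0 ≤ ∑ k, ∑ l, ξ k * B k l * ξ l) →
    F q' ≤ F (q' + (0, B))

variable [FiniteDimensional ℝ E]

theorem apply_jet_nonpos_of_strict_contact (hY : ∀ k, ContDiff ℝ 1 (Y k))
    (hF : HasStrictFDerivAt F F' (jet Y u₁ z)) (hell : IsEllipticAt F (jet Y u₁ z))
    (hu₁ : ContDiffAt ℝ 2 u₁ z) (hu₂ : ContDiffAt ℝ 2 u₂ z) (hle : ∀ᶠ x in 𝓝 z, u₁ x ≤ u₂ x)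
    (hFle : ∀ᶠ x in 𝓝 z, F (jet Y u₂ x) ≤ F (jet Y u₁ x)) (hz : u₁ z = u₂ z)
    (hΦ : ContDiffAt ℝ 2 Φ z) (hmax : ∀ᶠ x in 𝓝 z, x ≠ z → u₁ x = u₂ x → Φ x < Φ z) :
    F' (jet Y Φ z) ≤ 0 := by
  by_contra! hpos
  have hu₁' : ContinuousAt (fun q : E × ℝ => jet Y u₁ q.1) (z, 0) :=
    ContinuousAt.comp (f := Prod.fst) (continuousAt_jet (fun k => (hY k).contDiffAt) hu₁)
      continuousAt_fst
  have hΦ' : ContinuousAt (fun q : E × ℝ => jet Y Φ q.1) (z, 0) :=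
    ContinuousAt.comp (f := Prod.fst) (continuousAt_jet (fun k => (hY k).contDiffAt) hΦ)
      continuousAt_fst
  have hjet := (hu₁'.prodMk hΦ').prodMk (continuousAt_snd (p := (z, (0 : ℝ))))
  have hperturb : Tendsto (fun q : E × ℝ => jet Y u₁ q.1 + q.2 • jet Y Φ q.1) (𝓝 (z, 0))
      (𝓝 (jet Y u₁ z)) := by
    have h : ContinuousAt (fun q : E × ℝ => jet Y u₁ q.1 + q.2 • jet Y Φ q.1) (z, 0) :=
      hu₁'.add (continuousAt_snd.smul hΦ')
    simpa [ContinuousAt] using h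
  have hgood := (hjet.eventually (eventually_lt_add_smul_of_hasStrictFDerivAt hF hpos)).and
    (hperturb.eventually hell)
  rw [nhds_prod_eq] at hgood
  obtain ⟨P, hP, Q, hQ, hPQ⟩ := eventually_prod_iff.1 hgood
  have h₁ := hu₁.eventually (by simp)
  have h₂ := hu₂.eventually (by simp)
  have h := hΦ.eventually (by simp)
  obtain ⟨ε, ⟨hε0, hεQ⟩, x, ⟨hxP, hx₁, hx₂, hx, hxF⟩, hmin⟩ :=
    ((eventually_mem_nhdsWithin.and (nhdsWithin_le_nhds hQ)).and
      (eventually_exists_isLocalMin_sub_mul (d := fun y => u₂ y - u₁ y) (ψ := Φ)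
        (hP.and (h₁.and (h₂.and (h.and hFle))))
        ((h₁.and h₂).mono fun y hy => hy.2.continuousAt.sub hy.1.continuousAt)
        (h.mono fun y hy => hy.continuousAt) (hle.mono fun y hy => sub_nonneg.2 hy)
        (sub_eq_zero.2 hz.symm) (hmax.mono fun y hy hyz h0 =>
          hy hyz (sub_eq_zero.1 h0).symm))).exists
  obtain ⟨B, hB, hBx⟩ := exists_jet_eq_of_isLocalMin
    (fun k => (hY k).differentiable one_ne_zero x) hx₁ hx₂ hx hmin
  obtain ⟨hlt, hellx⟩ := hPQ hxP hεQ
  have hge := hellx B hB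
  rw [← hBx] at hge
  exact ((hlt hε0).trans_le (hge.trans hxF)).false

theorem apply_jet_nonpos_of_contact (hY : ∀ k, ContDiff ℝ 1 (Y k))
    (hF : HasStrictFDerivAt F F' (jet Y u₁ z)) (hell : IsEllipticAt F (jet Y u₁ z))
    (hu₁ : ContDiffAt ℝ 2 u₁ z) (hu₂ : ContDiffAt ℝ 2 u₂ z) (hle : ∀ᶠ x in 𝓝 z, u₁ x ≤ u₂ x)
    (hFle : ∀ᶠ x in 𝓝 z, F (jet Y u₂ x) ≤ F (jet Y u₁ x)) (hz : u₁ z = u₂ z)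
    (hΦ : ContDiffAt ℝ 2 Φ z) (hmax : ∀ᶠ x in 𝓝 z, u₁ x = u₂ x → Φ x ≤ Φ z) :
    F' (jet Y Φ z) ≤ 0 := by
  set N : E → ℝ := fun x => ‖toEuclidean (x - z)‖ ^ 2
  have hN : ContDiff ℝ 2 N :=
    ((toEuclidean (E := E)).contDiff.comp (contDiff_id.sub contDiff_const)).norm_sq ℝ
  have hNpos : ∀ x, x ≠ z → 0 < N x := fun x hx => by
    have : toEuclidean (x - z) ≠ 0 := by simpa [sub_eq_zero] using hx
    positivity
  have hδ : ∀ δ > 0, F' (jet Y Φ z) ≤ δ * F' (jet Y N z) := fun δ hδ => by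
    have h := apply_jet_nonpos_of_strict_contact (Φ := Φ + (-δ) • N) hY hF hell hu₁ hu₂ hle hFle
      hz (hΦ.add (contDiffAt_const.smul hN.contDiffAt)) <| hmax.mono fun x hx hxz hx12 => by
        have := mul_pos hδ (hNpos x hxz)
        have hNz : N z = 0 := by simp [N]
        simp only [Pi.add_apply, Pi.smul_apply, smul_eq_mul, hNz]
        linarith [hx hx12]
    rw [jet_add_smul (fun k => (hY k).differentiable one_ne_zero z) hΦ hN.contDiffAt, map_add,
      map_smul, smul_eq_mul] at h
    linarith
  have hlim : Tendsto (fun δ : ℝ => δ * F' (jet Y N z)) (𝓝[>] 0) (𝓝 0) :=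
    (by simpa using (continuous_mul_const (F' (jet Y N z))).tendsto 0 :
      Tendsto _ (𝓝 (0 : ℝ)) _).mono_left nhdsWithin_le_nhds
  exact ge_of_tendsto hlim (eventually_mem_nhdsWithin.mono hδ)

/-- Replacing `Φ` by `Φ + α (Φ - Φ z) ^ 2` with `α → ∞` isolates the second order part. -/
theorem apply_rankOne_nonpos_of_contact (hY : ∀ k, ContDiff ℝ 1 (Y k))
    (hF : HasStrictFDerivAt F F' (jet Y u₁ z)) (hell : IsEllipticAt F (jet Y u₁ z))
    (hu₁ : ContDiffAt ℝ 2 u₁ z) (hu₂ : ContDiffAt ℝ 2 u₂ z) (hle : ∀ᶠ x in 𝓝 z, u₁ x ≤ u₂ x)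
    (hFle : ∀ᶠ x in 𝓝 z, F (jet Y u₂ x) ≤ F (jet Y u₁ x)) (hz : u₁ z = u₂ z)
    (hΦ : ContDiffAt ℝ 2 Φ z) (hmax : ∀ᶠ x in 𝓝 z, u₁ x = u₂ x → Φ x ≤ Φ z) :
    F' (0, fun k l => hGrad Y Φ z k * hGrad Y Φ z l) ≤ 0 := by
  set b := F' (0, fun k l => hGrad Y Φ z k * hGrad Y Φ z l) with hb
  have hsq : ContDiffAt ℝ 2 (fun y => (Φ y - Φ z) ^ 2) z := (hΦ.sub contDiffAt_const).pow 2
  have hYd : ∀ k, DifferentiableAt ℝ (Y k) z := fun k => (hY k).differentiable one_ne_zero z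
  have hscaled : ∀ α : ℝ, F' (jet Y Φ z) + α * (2 * b) ≤ 0 := fun α => by
    have h := apply_jet_nonpos_of_contact (Φ := Φ + α • fun y => (Φ y - Φ z) ^ 2) hY hF hell hu₁
      hu₂ hle hFle hz (hΦ.add (contDiffAt_const.smul hsq)) <| by
        have hsmall : ∀ᶠ x in 𝓝 z, 0 < 1 + α * (Φ x - Φ z) := by
          refine ContinuousAt.eventually_lt continuousAt_const (continuousAt_const.add
            (continuousAt_const.mul (hΦ.continuousAt.sub continuousAt_const))) ?_
          simp
        filter_upwards [hmax, hsmall] with x hx hx' hx12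
        simp only [Pi.add_apply, Pi.smul_apply, smul_eq_mul, sub_self]
        nlinarith [mul_nonneg (sub_nonneg.2 (hx hx12)) hx'.le]
    rwa [jet_add_smul hYd hΦ hsq, jet_sub_const_sq hYd hΦ, map_add, map_smul, map_smul,
      smul_eq_mul, smul_eq_mul, ← hb] at h
  by_contra! hpos
  have h := hscaled (|F' (jet Y Φ z)| / b + 1)
  have : (|F' (jet Y Φ z)| / b + 1) * (2 * b) = 2 * |F' (jet Y Φ z)| + 2 * b := by
    field_simp
  linarith [neg_abs_le (F' (jet Y Φ z)), abs_nonneg (F' (jet Y Φ z))]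

end Comparison

/-! ### The first variation of the flux -/

section Determinant

variable {ι : Type*} [Fintype ι] [DecidableEq ι]

theorem sum_det_updateRow_apply {R : Type*} [CommRing R] (D : (ι → R) →ₗ[R] ι → R)
    (M : Matrix ι ι R) :
    ∑ i, (M.updateRow i (D (M i))).det = LinearMap.trace R _ D * M.det := by
  have hrow (i : ι) : (M.updateRow i (D (M i))).det =
      (M.transpose.adjugate * (D.toMatrix' * M.transpose)) i i := by
    rw [← Matrix.cramer_transpose_apply, Matrix.cramer_eq_adjugate_mulVec,
      ← Matrix.toLin'_toMatrix' D, Matrix.toLin'_apply, Matrix.mulVec_mulVec, ← Matrix.mul_assoc,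
      LinearMap.toMatrix'_toLin']
    rfl
  calc ∑ i, (M.updateRow i (D (M i))).det
      = (M.transpose.adjugate * (D.toMatrix' * M.transpose)).trace :=
        Finset.sum_congr rfl fun i _ => hrow i
    _ = (M.det • D.toMatrix').trace := by
        rw [Matrix.trace_mul_comm, Matrix.mul_assoc, Matrix.mul_adjugate, Matrix.det_transpose,
          Matrix.mul_smul, Matrix.mul_one]
    _ = LinearMap.trace R _ D * M.det := by
        rw [Matrix.trace_smul, smul_eq_mul, mul_comm, ← Matrix.trace_toLin'_eq,
          Matrix.toLin'_toMatrix']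

theorem sum_det_updateRow_smul_add_apply {R : Type*} [CommRing R] (D : (ι → R) →ₗ[R] ι → R)
    (M : Matrix ι ι R) {c : ι → R} {j : ι} (hc : c j = 0) :
    ∑ i, (M.updateRow i (c i • M j + D (M i))).det = LinearMap.trace R _ D * M.det := by
  rw [← sum_det_updateRow_apply]
  refine Finset.sum_congr rfl fun i _ => ?_
  rw [Matrix.det_updateRow_add, Matrix.det_updateRow_smul, add_eq_right]
  rcases eq_or_ne i j with rfl | hij
  · rw [hc, zero_mul]
  · rw [Matrix.det_updateRow_eq_zero hij.symm, mul_zero]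

/-- The determinant as a continuous multilinear function of the rows, for which Mathlib provides
the derivative. -/
def detRows (ι : Type*) [Fintype ι] [DecidableEq ι] :
    ContinuousMultilinearMap ℝ (fun _ : ι => ι → ℝ) ℝ :=
  ⟨(Matrix.detRowAlternating : (ι → ℝ) [⋀^ι]→ₗ[ℝ] ℝ).toMultilinearMap,
    Continuous.matrix_det (n := ι) (R := ℝ) continuous_id⟩

theorem hasDerivAt_det {A : ℝ → Matrix ι ι ℝ} {A' : Matrix ι ι ℝ} {t : ℝ}
    (hA : ∀ i, HasDerivAt (fun s => A s i) (A' i) t) :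
    HasDerivAt (fun s => (A s).det) (∑ i, ((A t).updateRow i (A' i)).det) t := by
  have h := ((detRows ι).hasFDerivAt (A t)).comp_hasDerivAt t (hasDerivAt_pi.2 hA)
  exact h.congr_deriv ((detRows ι).linearDeriv_apply (A t) A')

end Determinant

section Flux

/-- The divergence of a vector field `ν`, with respect to the Lebesgue measure. -/
def divergence {E : Type*} [NormedAddCommGroup E] [NormedSpace ℝ E] (ν : E → E) (x : E) : ℝ :=
  LinearMap.trace ℝ E (fderiv ℝ ν x).toLinearMap

variable {κ : Type*} [Fintype κ] [DecidableEq κ]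
  {ν : (κ ⊕ Unit → ℝ) → κ ⊕ Unit → ℝ} {γ : (κ → ℝ) → κ ⊕ Unit → ℝ} {f : (κ → ℝ) → ℝ} {y : κ → ℝ}

/-- The coefficient at `y` of the pullback by `γ` of the form `ν ⌟ dv`, with `ν` in the last
slot. -/
def flux (ν : (κ ⊕ Unit → ℝ) → κ ⊕ Unit → ℝ) (γ : (κ → ℝ) → κ ⊕ Unit → ℝ) (y : κ → ℝ) : ℝ :=
  Matrix.det (Sum.elim (fun k => fderiv ℝ γ y (Pi.single k 1)) fun _ => ν (γ y))

theorem contDiffAt_flux {Γ : ℝ → (κ → ℝ) → κ ⊕ Unit → ℝ} {t : ℝ}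
    (hΓ : ContDiffAt ℝ 2 (Function.uncurry Γ) (t, y)) (hν : ContDiffAt ℝ 1 ν (Γ t y)) :
    ContDiffAt ℝ 1 (Function.uncurry fun t => flux ν (Γ t)) (t, y) := by
  refine (detRows (κ ⊕ Unit)).contDiff.contDiffAt.comp (t, y)
    (g := fun M => detRows (κ ⊕ Unit) M) (contDiffAt_pi.2 ?_)
  rintro (k | _)
  · have hpair : ContDiffAt ℝ 2 (fun q : (ℝ × (κ → ℝ)) × (κ → ℝ) => Γ q.1.1 q.2) ((t, y), y) :=
      ContDiffAt.comp (g := Function.uncurry Γ) (f := fun q : (ℝ × (κ → ℝ)) × (κ → ℝ) =>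
        (q.1.1, q.2)) _ hΓ (by fun_prop)
    exact (ContDiffAt.fderiv (f := fun (q : ℝ × (κ → ℝ)) w => Γ q.1 w) (g := Prod.snd) hpair
      contDiffAt_snd (by norm_num)).clm_apply contDiffAt_const
  · exact ContDiffAt.comp (g := ν) (f := Function.uncurry Γ) (t, y) hν (hΓ.of_le (by norm_num))

theorem hasDerivAt_flux_add_smul (hν : DifferentiableAt ℝ ν (γ y)) (hγ : DifferentiableAt ℝ γ y)
    (hf : DifferentiableAt ℝ f y) :
    HasDerivAt (fun t : ℝ => flux ν (fun w => γ w + (t * f w) • ν (γ w)) y)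
      (f y * divergence ν (γ y) * flux ν γ y) 0 := by
  set D := fderiv ℝ ν (γ y) with hD
  set M : Matrix (κ ⊕ Unit) (κ ⊕ Unit) ℝ :=
    Sum.elim (fun k => fderiv ℝ γ y (Pi.single k 1)) (fun _ => ν (γ y)) with hM
  set c : κ ⊕ Unit → ℝ := Sum.elim (fun k => fderiv ℝ f y (Pi.single k 1)) (fun _ => 0) with hc
  have hνγ : HasFDerivAt (fun w => ν (γ w)) (D ∘L fderiv ℝ γ y) y :=
    hν.hasFDerivAt.comp y hγ.hasFDerivAt
  have hfderiv (t : ℝ) (v : κ → ℝ) : fderiv ℝ (fun w => γ w + (t * f w) • ν (γ w)) y v =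
      fderiv ℝ γ y v + t • (fderiv ℝ f y v • ν (γ y) + f y • D (fderiv ℝ γ y v)) := by
    rw [(hγ.hasFDerivAt.fun_add ((hf.hasFDerivAt.const_mul t).fun_smul hνγ)).fderiv]
    simp only [add_apply, smul_apply, ContinuousLinearMap.comp_apply,
      ContinuousLinearMap.smulRight_apply, smul_eq_mul]
    module
  have hline (v w : κ ⊕ Unit → ℝ) : HasDerivAt (fun t : ℝ => v + t • w) w 0 := by
    simpa using ((hasDerivAt_id (0 : ℝ)).smul_const w).const_add v
  have hrows : ∀ i, HasDerivAt (fun t : ℝ => (Sum.elim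
      (fun k => fderiv ℝ (fun w => γ w + (t * f w) • ν (γ w)) y (Pi.single k 1))
      (fun _ => ν (γ y + (t * f y) • ν (γ y))) : Matrix (κ ⊕ Unit) (κ ⊕ Unit) ℝ) i)
      (c i • M (Sum.inr ()) + (f y • D).toLinearMap (M i)) 0 := by
    rintro (k | _)
    · simp only [hfderiv, Sum.elim_inl]
      exact hline _ _
    · have hν' : HasFDerivAt ν D (γ y + (0 : ℝ) • (f y • ν (γ y))) := by
        simpa using hν.hasFDerivAt
      simpa [hc, hM, smul_smul, Function.comp_def] using
        hν'.comp_hasDerivAt (0 : ℝ) (hline (γ y) (f y • ν (γ y)))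
  have hrows₀ : (Sum.elim
      (fun k => fderiv ℝ (fun w => γ w + ((0 : ℝ) * f w) • ν (γ w)) y (Pi.single k 1))
      (fun _ => ν (γ y + ((0 : ℝ) * f y) • ν (γ y))) : Matrix (κ ⊕ Unit) (κ ⊕ Unit) ℝ) = M := by
    simp [hM]
  refine (hasDerivAt_det hrows).congr_deriv ?_
  rw [hrows₀, sum_det_updateRow_smul_add_apply _ _ (by simp [hc])]
  simp [flux, divergence, hM, hD]

theorem flux_ne_zero (hγ : Function.Injective (fderiv ℝ γ y)) {ℓ : (κ ⊕ Unit → ℝ) →L[ℝ] ℝ}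
    (hℓγ : ∀ v, ℓ (fderiv ℝ γ y v) = 0) (hℓν : ℓ (ν (γ y)) ≠ 0) : flux ν γ y ≠ 0 := by
  have hrows : LinearIndependent ℝ
      (Sum.elim (fun k => fderiv ℝ γ y (Pi.single k 1)) fun _ : Unit => ν (γ y)) := by
    have hbasis := (Pi.basisFun ℝ κ).linearIndependent.map' (fderiv ℝ γ y).toLinearMap
      (LinearMap.ker_eq_bot.2 hγ)
    have hν : ν (γ y) ≠ 0 := fun h => hℓν (by rw [h, map_zero])
    refine LinearIndependent.sum_type (by simpa [Function.comp_def] using hbasis)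
      (linearIndependent_unique_iff.2 hν) ?_
    rw [Set.range_const, Submodule.disjoint_span_singleton' hν]
    intro hmem
    refine hℓν (Submodule.span_le (p := LinearMap.ker ℓ.toLinearMap) |>.2 ?_ hmem)
    rintro _ ⟨k, rfl⟩
    exact hℓγ _
  exact ((Matrix.isUnit_iff_isUnit_det _).1
    (Matrix.linearIndependent_rows_iff_isUnit.1 hrows)).ne_zero

end Flux

section FirstVariation

variable {E F : Type*} [NormedAddCommGroup E] [NormedSpace ℝ E] [MeasurableSpace E]
  [OpensMeasurableSpace E] [NormedAddCommGroup F] [NormedSpace ℝ F]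

theorem hasDerivAt_setIntegral_of_contDiffAt {μ : Measure E} [IsFiniteMeasureOnCompacts μ]
    {J : ℝ → E → F} {K : Set E} {t₀ : ℝ} (hK : IsCompact K)
    (hJ : ∀ y ∈ K, ContDiffAt ℝ 1 (Function.uncurry J) (t₀, y)) :
    HasDerivAt (fun t => ∫ y in K, J t y ∂μ) (∫ y in K, deriv (fun t => J t y) t₀ ∂μ) t₀ := by
  set J' : ℝ × E → F := fun q => fderiv ℝ (Function.uncurry J) q (1, 0)
  have hJ' (q : ℝ × E) (hq : ContDiffAt ℝ 1 (Function.uncurry J) q) : ContinuousAt J' q :=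
    (hq.continuousAt_fderiv one_ne_zero).clm_apply continuousAt_const
  have hderiv (t : ℝ) (y : E) (h : ContDiffAt ℝ 1 (Function.uncurry J) (t, y)) :
      HasDerivAt (fun t => J t y) (J' (t, y)) t :=
    (h.differentiableAt one_ne_zero).hasFDerivAt.comp_hasDerivAt (f := fun t => (t, y)) t
      ((hasDerivAt_id t).prodMk (hasDerivAt_const t y))
  have hslice {G : ℝ × E → F} {t : ℝ} (hG : ∀ y ∈ K, ContinuousAt G (t, y)) :
      ContinuousOn (fun y => G (t, y)) K := fun y hy =>
    (ContinuousAt.comp (f := fun y => (t, y)) (hG y hy) (by fun_prop)).continuousWithinAt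
  have hslice₀ := hslice fun y hy => hJ' _ (hJ y hy)
  obtain ⟨C, hC⟩ := hK.exists_bound_of_continuousOn hslice₀
  have hnear : ∀ᶠ t in 𝓝 t₀, ∀ y ∈ K,
      ContDiffAt ℝ 1 (Function.uncurry J) (t, y) ∧ ‖J' (t, y)‖ < C + 1 :=
    hK.eventually_forall_of_forall_eventually fun y hy =>
      ((hJ y hy).eventually (by simp)).and ((hJ' _ (hJ y hy)).norm.eventually_lt
        continuousAt_const ((hC y hy).trans_lt (lt_add_one C)))
  have hJt : ∀ᶠ t in 𝓝 t₀, ContinuousOn (J t) K := hnear.mono fun t ht =>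
    hslice (G := Function.uncurry J) fun y hy => (ht y hy).1.continuousAt
  have hint : ∫ y in K, deriv (fun t => J t y) t₀ ∂μ = ∫ y in K, J' (t₀, y) ∂μ :=
    setIntegral_congr_fun hK.measurableSet fun y hy => (hderiv t₀ y (hJ y hy)).deriv
  rw [hint]
  refine (hasDerivAt_integral_of_dominated_loc_of_deriv_le (F' := fun t y => J' (t, y))
    (bound := fun _ => C + 1) hnear ?_ ?_ ?_ ?_ ?_ ?_).2
  · exact hJt.mono fun t ht => ht.aestronglyMeasurable_of_isCompact hK hK.measurableSet
  · exact hJt.self_of_nhds.integrableOn_compact hK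
  · exact hslice₀.aestronglyMeasurable_of_isCompact hK hK.measurableSet
  · filter_upwards [ae_restrict_mem hK.measurableSet] with y hy t ht using (ht y hy).2.le
  · exact continuousOn_const.integrableOn_compact hK
  · filter_upwards [ae_restrict_mem hK.measurableSet] with y hy t ht using hderiv t y (ht y hy).1

variable {κ : Type*} [Fintype κ] [DecidableEq κ] {ν : (κ ⊕ Unit → ℝ) → κ ⊕ Unit → ℝ}
  {γ : (κ → ℝ) → κ ⊕ Unit → ℝ} {f : (κ → ℝ) → ℝ} {K : Set (κ → ℝ)}

theorem hasDerivAt_integral_flux_add_smul (hK : IsCompact K)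
    (hν : ∀ y ∈ K, ContDiffAt ℝ 2 ν (γ y)) (hγ : ∀ y ∈ K, ContDiffAt ℝ 2 γ y)
    (hf : ∀ y ∈ K, ContDiffAt ℝ 2 f y) :
    HasDerivAt (fun t : ℝ => ∫ y in K, flux ν (fun w => γ w + (t * f w) • ν (γ w)) y)
      (∫ y in K, f y * divergence ν (γ y) * flux ν γ y) 0 := by
  have hderiv := hasDerivAt_setIntegral_of_contDiffAt (μ := volume) (t₀ := 0) hK
    (J := fun t => flux ν fun w => γ w + (t * f w) • ν (γ w)) fun y hy => by
      refine contDiffAt_flux ?_ ?_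
      · have hγ' := (hγ y hy).comp ((0 : ℝ), y) contDiffAt_snd
        have hf' := (hf y hy).comp ((0 : ℝ), y) contDiffAt_snd
        exact hγ'.add ((contDiffAt_fst.mul hf').smul
          ((hν y hy).comp ((0 : ℝ), y) hγ'))
      · simpa using (hν y hy).of_le (by norm_num)
  refine hderiv.congr_deriv (setIntegral_congr_fun hK.measurableSet fun y hy => ?_)
  exact (hasDerivAt_flux_add_smul ((hν y hy).differentiableAt two_ne_zero)
    ((hγ y hy).differentiableAt two_ne_zero) ((hf y hy).differentiableAt two_ne_zero)).deriv

end FirstVariation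

section Divergence

variable {E κ : Type*} [NormedAddCommGroup E] [NormedSpace ℝ E] {x : E}

theorem contDiffAt_hGrad {Y : κ → E → E} {u : E → ℝ} (hu : ContDiffAt ℝ ∞ u x) {k : κ}
    (hY : ContDiffAt ℝ ∞ (Y k) x) : ContDiffAt ℝ ∞ (fun y => hGrad Y u y k) x :=
  (hu.fderiv_right (m := ∞) (by simp)).clm_apply hY

theorem contDiffAt_sum_sq_rpow [Fintype κ] {v : E → κ → ℝ}
    (hv : ∀ k, ContDiffAt ℝ ∞ (fun y => v y k) x) (hne : v x ≠ 0) (r : ℝ) :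
    ContDiffAt ℝ ∞ (fun y => (∑ k, v y k ^ 2) ^ r) x :=
  (ContDiffAt.sum fun k _ => (hv k).pow 2).rpow_const_of_ne (sum_sq_pos hne).ne'

variable [FiniteDimensional ℝ E]

theorem continuousAt_divergence {ν : E → E} (hν : ContDiffAt ℝ 1 ν x) :
    ContinuousAt (divergence ν) x :=
  ContinuousAt.comp
    (g := LinearMap.trace ℝ E ∘ₗ ContinuousLinearMap.coeLM ℝ (M := E) (N₃ := E))
    (LinearMap.continuous_of_finiteDimensional _).continuousAt (hν.continuousAt_fderiv one_ne_zero)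

theorem divergence_sum_smul [Fintype κ] {c : κ → E → ℝ} {Y : κ → E → E}
    (hc : ∀ k, DifferentiableAt ℝ (c k) x) (hY : ∀ k, DifferentiableAt ℝ (Y k) x) :
    divergence (fun y => ∑ k, c k y • Y k y) x =
      ∑ k, (c k x * divergence (Y k) x + fderiv ℝ (c k) x (Y k x)) := by
  rw [divergence, fderiv_fun_sum fun k _ => (hc k).fun_smul (hY k)]
  simp only [fderiv_fun_smul (hc _) (hY _), ContinuousLinearMap.toLinearMap_sum,
    ContinuousLinearMap.toLinearMap_add, ContinuousLinearMap.toLinearMap_smul, map_sum, map_add,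
    map_smul, smul_eq_mul, divergence]
  exact Finset.sum_congr rfl fun k _ => congrArg _ (LinearMap.trace_smulRight _ _)

end Divergence

section NormalField

variable {n : ℕ} {p : ℝ} {φ : Heis n → ℝ} {x : Heis n}

theorem contDiff_frame (k : Fin n ⊕ Fin n) : ContDiff ℝ ∞ (frame (n := n) k) := by
  rcases k with j | j <;> unfold frame <;> fun_prop

theorem divergence_frame (k : Fin n ⊕ Fin n) (x : Heis n) : divergence (frame k) x = 0 := by
  have hshear (ν : Heis n → Heis n) (v : Heis n) (i) (c : ℝ)
      (hν : ∀ q, ν q = v + (c * q (Sum.inl i)) • ddz) : divergence ν x = 0 := by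
    have hcoord : HasFDerivAt (fun q : Heis n => c * q (Sum.inl i))
        (c • ContinuousLinearMap.proj (R := ℝ) (φ := fun _ => ℝ) (Sum.inl i)) x :=
      (hasFDerivAt_apply (Sum.inl i) x).const_mul c
    rw [funext hν, divergence, ((hcoord.smul_const ddz).const_add v).fderiv]
    exact (LinearMap.trace_smulRight _ _).trans (by simp [ddz])
  rcases k with j | j
  · exact hshear _ (ddx j) (Sum.inr j) 1 fun q => by simp [frame]
  · exact hshear _ (ddy j) (Sum.inl j) (-1) fun q => by simp [frame, sub_eq_add_neg]

theorem coInner_fderiv_self :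
    coInner x (fderiv ℝ φ x) (fderiv ℝ φ x) = ∑ k, hGrad frame φ x k ^ 2 := by
  simp only [coInner, hGrad, sq]

theorem coNorm_fderiv_ne_zero_iff : coNorm x (fderiv ℝ φ x) ≠ 0 ↔ hGrad frame φ x ≠ 0 := by
  rw [coNorm, coInner_fderiv_self]
  refine ⟨fun h h0 => h (by simp [h0]), fun h => (Real.sqrt_pos.2 (sum_sq_pos h)).ne'⟩

theorem pNormal_eq_sum (p : ℝ) (φ : Heis n → ℝ) (x : Heis n) : pNormal p φ x =
    ∑ k, ((∑ l, hGrad frame φ x l ^ 2) ^ ((p - 1) / 2) * hGrad frame φ x k) • frame k x := by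
  have hS : 0 ≤ ∑ l, hGrad frame φ x l ^ 2 := Finset.sum_nonneg fun _ _ => sq_nonneg _
  have hexp : 1 / 2 * -(1 - p) = (p - 1) / 2 := by ring
  rw [pNormal, coNorm, coInner_fderiv_self, Real.sqrt_eq_rpow,
    ← Real.rpow_neg (Real.rpow_nonneg hS _), ← Real.rpow_mul hS, hexp, sharp, Finset.smul_sum]
  simp only [smul_smul, hGrad]

theorem contDiffAt_hGrad_frame (hφ : ContDiffAt ℝ ∞ φ x) (k : Fin n ⊕ Fin n) :
    ContDiffAt ℝ ∞ (fun y => hGrad frame φ y k) x :=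
  contDiffAt_hGrad hφ (contDiff_frame k).contDiffAt

theorem contDiffAt_pNormal (p : ℝ) (hφ : ContDiffAt ℝ ∞ φ x) (hne : hGrad frame φ x ≠ 0) :
    ContDiffAt ℝ ∞ (pNormal p φ) x := by
  rw [funext (pNormal_eq_sum p φ)]
  exact ContDiffAt.sum fun k _ =>
    ((contDiffAt_sum_sq_rpow (contDiffAt_hGrad_frame hφ) hne _).mul
      (contDiffAt_hGrad_frame hφ k)).smul (contDiff_frame k).contDiffAt

theorem fderiv_pNormal_pos (p : ℝ) (hne : hGrad frame φ x ≠ 0) :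
    0 < fderiv ℝ φ x (pNormal p φ x) := by
  have hS := sum_sq_pos hne
  have hsq : fderiv ℝ φ x (pNormal p φ x) =
      (∑ l, hGrad frame φ x l ^ 2) ^ ((p - 1) / 2) * ∑ l, hGrad frame φ x l ^ 2 := by
    simp only [pNormal_eq_sum, map_sum, map_smul, smul_eq_mul, Finset.mul_sum, hGrad]
    exact Finset.sum_congr rfl fun k _ => by ring
  rw [hsq]
  positivity

theorem divergence_pNormal (p : ℝ) (hφ : ContDiffAt ℝ ∞ φ x) (hne : hGrad frame φ x ≠ 0) :
    divergence (pNormal p φ) x = curvOp p (hGrad frame φ x) (hHess frame φ x) := by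
  have hv k : HasFDerivAt (fun y => hGrad frame φ y k)
      (fderiv ℝ (fun y => hGrad frame φ y k) x) x :=
    ((contDiffAt_hGrad_frame hφ k).differentiableAt (by simp)).hasFDerivAt
  have hS : HasFDerivAt (fun y => ∑ l, hGrad frame φ y l ^ 2)
      (∑ l, (2 * hGrad frame φ x l) • fderiv ℝ (fun y => hGrad frame φ y l) x) x :=
    HasFDerivAt.fun_sum fun l _ => by simpa using (hv l).pow 2
  have hc k := (hS.rpow_const (p := (p - 1) / 2) (Or.inl (sum_sq_pos hne).ne')).fun_mul (hv k)
  have hexp : (p - 1) / 2 - 1 = (p - 3) / 2 := by ring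
  rw [funext (pNormal_eq_sum p φ), divergence_sum_smul (fun k => (hc k).differentiableAt)
    fun k => (contDiff_frame k).differentiable (by simp) x]
  have hterm k : fderiv ℝ (fun y => (∑ l, hGrad frame φ y l ^ 2) ^ ((p - 1) / 2) *
      hGrad frame φ y k) x (frame k x) =
      (∑ l, hGrad frame φ x l ^ 2) ^ ((p - 1) / 2) * hHess frame φ x k k +
      (p - 1) * (∑ l, hGrad frame φ x l ^ 2) ^ ((p - 3) / 2) *
        ∑ l, hGrad frame φ x k * hHess frame φ x k l * hGrad frame φ x l := by
    rw [(hc k).fderiv, hexp]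
    simp only [add_apply, smul_apply, sum_apply, smul_eq_mul, Finset.mul_sum, hHess]
    exact congrArg _ (Finset.sum_congr rfl fun l _ => by ring)
  simp only [divergence_frame, mul_zero, zero_add, hterm, Finset.sum_add_distrib, curvOp,
    Finset.mul_sum]

end NormalField

section MeanCurvature

theorem eqOn_of_forall_setIntegral_tsupport_eq {E : Type*} [NormedAddCommGroup E] [NormedSpace ℝ E]
    [FiniteDimensional ℝ E] [MeasurableSpace E] [BorelSpace E] {μ : Measure E}
    [IsLocallyFiniteMeasure μ] [μ.IsOpenPosMeasure] {B : Set E} {g₁ g₂ : E → ℝ} (hB : IsOpen B)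
    (hg₁ : ContinuousOn g₁ B) (hg₂ : ContinuousOn g₂ B)
    (h : ∀ f : E → ℝ, ContDiff ℝ ∞ f → HasCompactSupport f → tsupport f ⊆ B →
      ∫ x in tsupport f, f x * g₁ x ∂μ = ∫ x in tsupport f, f x * g₂ x ∂μ) :
    Set.EqOn g₁ g₂ B := by
  have hae : ∀ᵐ x ∂μ, x ∈ B → (g₁ - g₂) x = 0 := by
    refine hB.ae_eq_zero_of_integral_contDiff_smul_eq_zero
      ((hg₁.sub hg₂).locallyIntegrableOn hB.measurableSet) fun f hf hfc hfB => ?_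
    have hint {g : E → ℝ} (hg : ContinuousOn g B) :
        IntegrableOn (fun x => f x * g x) (tsupport f) μ :=
      (hf.continuous.continuousOn.mul (hg.mono hfB)).integrableOn_compact hfc
    have hzero : ∀ x ∉ tsupport f, f x • (g₁ - g₂) x = 0 := fun x hx => by
      rw [image_eq_zero_of_notMem_tsupport hx, zero_smul]
    rw [← setIntegral_eq_integral_of_forall_compl_eq_zero hzero]
    simp only [Pi.sub_apply, smul_eq_mul, mul_sub]
    rw [integral_sub (hint hg₁) (hint hg₂), h f hf hfc hfB, sub_self]
  have hzero : Set.EqOn (g₁ - g₂) 0 B := Measure.eqOn_open_of_ae_eq (μ := μ)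
    ((ae_restrict_iff' hB.measurableSet).2 hae) hB (hg₁.sub hg₂) continuousOn_const
  exact fun x hx => sub_eq_zero.1 (hzero hx)

theorem continuousAt_flux {κ : Type*} [Fintype κ] [DecidableEq κ]
    {ν : (κ ⊕ Unit → ℝ) → κ ⊕ Unit → ℝ} {γ : (κ → ℝ) → κ ⊕ Unit → ℝ} {y : κ → ℝ}
    (hγ : ContDiffAt ℝ 2 γ y) (hν : ContDiffAt ℝ 1 ν (γ y)) : ContinuousAt (flux ν γ) y :=
  ContinuousAt.comp (f := fun w => ((0 : ℝ), w))
    (contDiffAt_flux (Γ := fun _ => γ) (hγ.comp (f := Prod.snd) (0, y) contDiffAt_snd)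
      hν).continuousAt (by fun_prop)

variable {n : ℕ} {p : ℝ} {φ : Heis n → ℝ} {S V : Set (Heis n)}

theorem satisfiesFirstVariation_divergence_pNormal (p : ℝ) (S : Set (Heis n))
    (hφ : ∀ x ∈ V, ContDiffAt ℝ ∞ φ x) (hne : ∀ x ∈ V, hGrad frame φ x ≠ 0) :
    SatisfiesFirstVariation p φ S V (divergence (pNormal p φ)) := by
  have hν x (hx : x ∈ V) := contDiffAt_pNormal p (hφ x hx) (hne x hx)
  refine ⟨fun x hx => (continuousAt_divergence
    ((hν x hx.2).of_le (by simp))).continuousWithinAt, ?_⟩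
  intro B γ hB hγ _ _ hmaps f hf hfc hfB
  exact hasDerivAt_integral_flux_add_smul hfc
    (fun y hy => (hν _ (hmaps (hfB hy)).2).of_le ENat.LEInfty.out)
    (fun y hy => (hγ.contDiffAt (hB.mem_nhds (hfB hy))).of_le ENat.LEInfty.out)
    (fun y _ => hf.contDiffAt.of_le ENat.LEInfty.out)

theorem flux_pNormal_ne_zero {γ : (Fin n ⊕ Fin n → ℝ) → Heis n} {y : Fin n ⊕ Fin n → ℝ}
    (p : ℝ) (hφ : DifferentiableAt ℝ φ (γ y)) (hne : hGrad frame φ (γ y) ≠ 0)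
    (hγ : DifferentiableAt ℝ γ y) (himm : Function.Injective (fderiv ℝ γ y))
    (h0 : ∀ᶠ w in 𝓝 y, φ (γ w) = 0) : flux (pNormal p φ) γ y ≠ 0 := by
  have hcomp : (fderiv ℝ φ (γ y)) ∘L (fderiv ℝ γ y) = 0 :=
    (hφ.hasFDerivAt.comp y hγ.hasFDerivAt).unique
      ((hasFDerivAt_const (0 : ℝ) y).congr_of_eventuallyEq h0)
  exact flux_ne_zero himm (fun v => congrArg (fun L => L v) hcomp) (fderiv_pNormal_pos p hne).ne'

theorem SatisfiesFirstVariation.eqOn_divergence_pNormal {H : Heis n → ℝ}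
    (hH : SatisfiesFirstVariation p φ S V H) (hφ : ∀ x ∈ V, ContDiffAt ℝ ∞ φ x)
    (hne : ∀ x ∈ V, hGrad frame φ x ≠ 0) (hS : ∀ x ∈ S ∩ V, φ x = 0)
    {B : Set (Fin n ⊕ Fin n → ℝ)} {γ : (Fin n ⊕ Fin n → ℝ) → Heis n} (hB : IsOpen B)
    (hγ : ContDiffOn ℝ ∞ γ B) (hinj : Set.InjOn γ B)
    (himm : ∀ y ∈ B, Function.Injective (fderiv ℝ γ y)) (hmaps : Set.MapsTo γ B (S ∩ V)) :
    Set.EqOn (H ∘ γ) (divergence (pNormal p φ) ∘ γ) B := by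
  have hdiv := satisfiesFirstVariation_divergence_pNormal p S hφ hne
  have hγ' y (hy : y ∈ B) : ContDiffAt ℝ ∞ γ y := hγ.contDiffAt (hB.mem_nhds hy)
  have hflux : ContinuousOn (flux (pNormal p φ) γ) B := fun y hy =>
    (continuousAt_flux ((hγ' y hy).of_le ENat.LEInfty.out) ((contDiffAt_pNormal p
      (hφ _ (hmaps hy).2) (hne _ (hmaps hy).2)).of_le (by simp))).continuousWithinAt
  have hprod := eqOn_of_forall_setIntegral_tsupport_eq (μ := volume)
    (g₁ := fun y => H (γ y) * flux (pNormal p φ) γ y)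
    (g₂ := fun y => divergence (pNormal p φ) (γ y) * flux (pNormal p φ) γ y) hB
    ((hH.1.comp hγ.continuousOn hmaps).mul hflux) ((hdiv.1.comp hγ.continuousOn hmaps).mul hflux)
    fun f hf hfc hfB => by
      simp only [← mul_assoc]
      exact (hH.2 B γ hB hγ hinj himm hmaps f hf hfc hfB).unique
        (hdiv.2 B γ hB hγ hinj himm hmaps f hf hfc hfB)
  intro y hy
  refine mul_right_cancel₀ (flux_pNormal_ne_zero p ?_ (hne _ (hmaps hy).2) ?_ (himm y hy) ?_)
    (hprod hy)
  · exact (hφ _ (hmaps hy).2).differentiableAt (by simp)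
  · exact (hγ' y hy).differentiableAt (by simp)
  · filter_upwards [hB.mem_nhds hy] with w hw using hS _ (hmaps hw)

end MeanCurvature

/-! ### Graphs over the orbit space -/

section OrbitSpace

variable {n : ℕ} [NeZero n]

/-- The space of orbits of the translations `l_a`, in the coordinates of `slice`. -/
abbrev OrbitSpace (n : ℕ) : Type := Fin n ⊕ Fin n → ℝ

/-- The projection to the orbit space, in the invariant coordinates
`(z + x_1 y_1, x_2, …, x_n, y_1, …, y_n)`; the first one is indexed by `inl 0`. -/
def slice (q : Heis n) : OrbitSpace n := fun k =>
  if k = Sum.inl 0 then q (Sum.inr ()) + q (Sum.inl (Sum.inl 0)) * q (Sum.inl (Sum.inr 0))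
  else q (Sum.inl k)

/-- The point with `x_1 = t` on the orbit `w`. -/
def orbitPoint (t : ℝ) (w : OrbitSpace n) : Heis n :=
  Sum.elim (fun k => if k = Sum.inl 0 then t else w k)
    fun _ => w (Sum.inl 0) - t * w (Sum.inr 0)

/-- The projections of the horizontal frame to the orbit space. -/
def sliceFrame : Fin n ⊕ Fin n → OrbitSpace n → OrbitSpace n
  | Sum.inl j, w => if j = 0 then (2 * w (Sum.inr 0)) • Pi.single (Sum.inl 0) 1 else
      Pi.single (Sum.inl j) 1 + w (Sum.inr j) • Pi.single (Sum.inl 0) 1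
  | Sum.inr j, w => if j = 0 then Pi.single (Sum.inr 0) 1 else
      Pi.single (Sum.inr j) 1 - w (Sum.inl j) • Pi.single (Sum.inl 0) 1

theorem contDiff_sliceFrame (k : Fin n ⊕ Fin n) : ContDiff ℝ ∞ (sliceFrame (n := n) k) := by
  rcases k with j | j <;> unfold sliceFrame <;> dsimp only <;> split_ifs <;> fun_prop

theorem contDiff_slice : ContDiff ℝ ∞ (slice (n := n)) := by
  refine contDiff_pi.2 fun k => ?_
  unfold slice
  split_ifs <;> fun_prop

theorem contDiff_orbitPoint :
    ContDiff ℝ ∞ fun y : OrbitSpace n × ℝ => orbitPoint y.2 y.1 := by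
  refine contDiff_pi.2 ?_
  rintro (k | _)
  · simp only [orbitPoint, Sum.elim_inl]
    split_ifs <;> fun_prop
  · simp only [orbitPoint, Sum.elim_inr]
    fun_prop

theorem slice_orbitPoint (t : ℝ) (w : OrbitSpace n) : slice (orbitPoint t w) = w := by
  funext k
  by_cases h : k = Sum.inl 0 <;> simp [slice, orbitPoint, h]

theorem orbitPoint_apply_zero (t : ℝ) (w : OrbitSpace n) :
    orbitPoint t w (Sum.inl (Sum.inl 0)) = t := by simp [orbitPoint]

theorem orbitPoint_slice (q : Heis n) : orbitPoint (q (Sum.inl (Sum.inl 0))) (slice q) = q := by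
  funext k
  rcases k with k | k
  · by_cases h : k = Sum.inl 0 <;> simp [slice, orbitPoint, h]
  · simp [slice, orbitPoint]

theorem lTrans_orbitPoint (a t : ℝ) (w : OrbitSpace n) :
    lTrans a (orbitPoint t w) = orbitPoint (t + a) w := by
  funext k
  rcases k with k | k
  · by_cases h : k = Sum.inl 0 <;> simp [lTrans, orbitPoint, ddx, ddz, h]
  · suffices w (Sum.inl 0) - t * w (Sum.inr 0) + -(a * w (Sum.inr 0)) =
        w (Sum.inl 0) - (t + a) * w (Sum.inr 0) by simpa [lTrans, orbitPoint, ddx, ddz]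
    ring

theorem lTrans_eq_orbitPoint (a : ℝ) (q : Heis n) :
    lTrans a q = orbitPoint (q (Sum.inl (Sum.inl 0)) + a) (slice q) := by
  rw [← lTrans_orbitPoint, orbitPoint_slice]

theorem fderiv_slice (q v : Heis n) (k : Fin n ⊕ Fin n) : fderiv ℝ slice q v k =
    if k = Sum.inl 0 then v (Sum.inr ()) + (v (Sum.inl (Sum.inl 0)) * q (Sum.inl (Sum.inr 0))
      + q (Sum.inl (Sum.inl 0)) * v (Sum.inl (Sum.inr 0))) else v (Sum.inl k) := by
  have hline : HasDerivAt (fun t : ℝ => slice (q + t • v)) (fderiv ℝ slice q v) 0 :=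
    ((contDiff_slice.differentiable (by simp)) q).hasFDerivAt.hasLineDerivAt v
  have hcoord i : HasDerivAt (fun t : ℝ => (q + t • v) i) (v i) 0 := by
    simpa using ((hasDerivAt_id (0 : ℝ)).mul_const (v i)).const_add (q i)
  refine (hasDerivAt_pi.1 hline k).unique ?_
  simp only [slice]
  split_ifs
  · simpa using (hcoord (Sum.inr ())).fun_add
      ((hcoord (Sum.inl (Sum.inl 0))).fun_mul (hcoord (Sum.inl (Sum.inr 0))))
  · exact hcoord _

theorem fderiv_slice_frame (q : Heis n) (k : Fin n ⊕ Fin n) :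
    fderiv ℝ slice q (frame k q) = sliceFrame k (slice q) := by
  funext l
  rw [fderiv_slice]
  rcases k with j | j <;> by_cases hj : j = 0 <;> by_cases hl : l = Sum.inl 0
  all_goals simp [frame, sliceFrame, slice, ddx, ddy, ddz, hj, hl, Pi.single_apply, eq_comm]
  all_goals ring

end OrbitSpace

section Graph

variable {n : ℕ} [NeZero n] {u : OrbitSpace n → ℝ} {w : OrbitSpace n} {S : Set (Heis n)}
  {q : Heis n}

/-- The parametrization of the graph `x_1 = u` by the orbit space. -/
def graphMap (u : OrbitSpace n → ℝ) (w : OrbitSpace n) : Heis n := orbitPoint (u w) w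

/-- The defining function `u - x_1` of the graph `x_1 = u`. -/
def graphFun (u : OrbitSpace n → ℝ) (q : Heis n) : ℝ := u (slice q) - q (Sum.inl (Sum.inl 0))

/-- The derivatives of `graphFun u` along the horizontal frame, as functions on the orbit space. -/
def graphGrad (u : OrbitSpace n → ℝ) (w : OrbitSpace n) : Fin n ⊕ Fin n → ℝ :=
  hGrad sliceFrame u w - Pi.single (Sum.inl 0) 1

theorem slice_graphMap (u : OrbitSpace n → ℝ) (w : OrbitSpace n) : slice (graphMap u w) = w :=
  slice_orbitPoint _ _

theorem graphFun_lTrans (u : OrbitSpace n → ℝ) (a : ℝ) (q : Heis n) :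
    graphFun u (lTrans a q) = graphFun u q - a := by
  rw [lTrans_eq_orbitPoint, graphFun, slice_orbitPoint, orbitPoint_apply_zero, graphFun]
  ring

theorem lTrans_graphFun (u : OrbitSpace n → ℝ) (q : Heis n) :
    lTrans (graphFun u q) q = graphMap u (slice q) := by
  rw [lTrans_eq_orbitPoint, graphFun, add_sub_cancel, graphMap]

theorem contDiffAt_graphMap {m : ℕ∞} (hu : ContDiffAt ℝ m u w) : ContDiffAt ℝ m (graphMap u) w :=
  (contDiff_orbitPoint.of_le (mod_cast le_top)).contDiffAt.comp w (contDiffAt_id.prodMk hu)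

theorem contDiffAt_graphFun (hu : ContDiffAt ℝ ∞ u (slice q)) : ContDiffAt ℝ ∞ (graphFun u) q :=
  (hu.comp q contDiff_slice.contDiffAt).sub (contDiff_apply ℝ ℝ _).contDiffAt

theorem injective_fderiv_graphMap (hu : DifferentiableAt ℝ (graphMap u) w) :
    Function.Injective (fderiv ℝ (graphMap u) w) := by
  have hcomp := ((contDiff_slice.differentiable (by simp)) (graphMap u w)).hasFDerivAt.comp w
    hu.hasFDerivAt
  rw [show slice ∘ graphMap u = id from funext (slice_graphMap u)] at hcomp
  exact Function.LeftInverse.injective fun v =>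
    congrArg (fun L => L v) (hcomp.unique (hasFDerivAt_id w))

theorem continuousAt_graphGrad (hu : ContDiffAt ℝ ∞ u w) : ContinuousAt (graphGrad u) w :=
  (continuousAt_pi.2 fun k => (contDiffAt_hGrad hu
    (contDiff_sliceFrame k).contDiffAt).continuousAt).sub continuousAt_const

theorem hGrad_graphFun (hu : DifferentiableAt ℝ u (slice q)) :
    hGrad frame (graphFun u) q = graphGrad u (slice q) := by
  funext k
  have hslice : HasFDerivAt (fun q => u (slice q)) (fderiv ℝ u (slice q) ∘L fderiv ℝ slice q) q :=
    hu.hasFDerivAt.comp q ((contDiff_slice.differentiable (by simp)) q).hasFDerivAt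
  have hx : frame k q (Sum.inl (Sum.inl 0)) = (Pi.single (Sum.inl 0) 1 : Fin n ⊕ Fin n → ℝ) k := by
    rcases k with j | j <;> simp [frame, ddx, ddy, ddz, Pi.single_apply, eq_comm]
  have h : fderiv ℝ (graphFun u) q =
      fderiv ℝ u (slice q) ∘L fderiv ℝ slice q - .proj (Sum.inl (Sum.inl 0)) :=
    (hslice.fun_sub (hasFDerivAt_apply (Sum.inl (Sum.inl 0)) q)).fderiv
  rw [hGrad, h]
  simp [graphGrad, hGrad, fderiv_slice_frame, hx]

theorem hHess_graphFun (hu : ContDiffAt ℝ 2 u (slice q)) :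
    hHess frame (graphFun u) q = hHess sliceFrame u (slice q) := by
  funext k l
  have hgrad : (fun x => hGrad frame (graphFun u) x l) =ᶠ[𝓝 q]
      fun x => graphGrad u (slice x) l := by
    filter_upwards [contDiff_slice.continuous.continuousAt.eventually
      (hu.eventually (by simp))] with x hx
    rw [hGrad_graphFun (hx.differentiableAt two_ne_zero)]
  have hl : DifferentiableAt ℝ (fun w => graphGrad u w l) (slice q) :=
    ((differentiableAt_fderiv_of_contDiffAt_two hu).clm_apply
      ((contDiff_sliceFrame l).differentiable (by simp) _)).sub_const _
  rw [hHess, hgrad.fderiv_eq, fderiv_fun_comp q hl (contDiff_slice.differentiable (by simp) q),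
    ContinuousLinearMap.comp_apply, fderiv_slice_frame]
  exact congrArg (fun L : OrbitSpace n →L[ℝ] ℝ => L _) (fderiv_sub_const _)

/-- Near `q ∈ S` the set `S` is the graph `x_1 = u` over the orbit space, with `u` smooth. -/
structure IsGraphAt (S : Set (Heis n)) (u : OrbitSpace n → ℝ) (q : Heis n) : Prop where
  mem : q ∈ S
  contDiffAt : ∀ᶠ w in 𝓝 (slice q), ContDiffAt ℝ ∞ u w
  mem_iff : ∀ᶠ x in 𝓝 q, x ∈ S ↔ x (Sum.inl (Sum.inl 0)) = u (slice x)

namespace IsGraphAt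

theorem apply_slice (h : IsGraphAt S u q) : u (slice q) = q (Sum.inl (Sum.inl 0)) :=
  (h.mem_iff.self_of_nhds.1 h.mem).symm

theorem graphMap_slice (h : IsGraphAt S u q) : graphMap u (slice q) = q := by
  rw [graphMap, h.apply_slice, orbitPoint_slice]

theorem eventually_isGraphAt (h : IsGraphAt S u q) : ∀ᶠ x in 𝓝[S] q, IsGraphAt S u x := by
  filter_upwards [self_mem_nhdsWithin, nhdsWithin_le_nhds h.mem_iff.eventually_nhds,
    nhdsWithin_le_nhds (contDiff_slice.continuous.continuousAt.eventually
      h.contDiffAt.eventually_nhds)] with x hx hiff hu using ⟨hx, hu, hiff⟩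

theorem tendsto_graphMap (h : IsGraphAt S u q) :
    Tendsto (graphMap u) (𝓝 (slice q)) (𝓝[S] q) := by
  have hcont : Tendsto (graphMap u) (𝓝 (slice q)) (𝓝 q) := by
    have := (contDiffAt_graphMap (m := ⊤) h.contDiffAt.self_of_nhds).continuousAt.tendsto
    rwa [h.graphMap_slice] at this
  refine tendsto_nhdsWithin_iff.2 ⟨hcont, ?_⟩
  filter_upwards [hcont.eventually h.mem_iff] with w hw
  rw [hw, slice_graphMap, graphMap, orbitPoint_apply_zero]

theorem eventuallyEq_graphFun {φ : Heis n → ℝ} {V : Set (Heis n)} (h : IsGraphAt S u q)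
    (hV : V ∈ 𝓝 q) (hφS : ∀ x ∈ S ∩ V, φ x = 0) (hφ : IsCompatible φ V) :
    φ =ᶠ[𝓝 q] graphFun u := by
  obtain ⟨δ, hδ, hcomp⟩ := hφ
  have hsmall : ∀ᶠ x in 𝓝 q, |graphFun u x| < δ := by
    have h0 : graphFun u q = 0 := by
      rw [graphFun, h.apply_slice, sub_self]
    refine (contDiffAt_graphFun h.contDiffAt.self_of_nhds).continuousAt.abs.eventually_lt
      continuousAt_const ?_
    rwa [h0, abs_zero]
  have hgraph : ∀ᶠ x in 𝓝 q, graphMap u (slice x) ∈ S ∩ V :=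
    (contDiff_slice.continuous.tendsto q).eventually (h.tendsto_graphMap.eventually
      (eventually_mem_nhdsWithin.and (nhdsWithin_le_nhds hV)))
  filter_upwards [hV, hsmall, hgraph] with x hx hxδ hxS
  rw [← lTrans_graphFun] at hxS
  linarith [hcomp x hx _ hxδ hxS.2, hφS _ hxS]

theorem isMeanCurvatureAt (h : IsGraphAt S u q) (p : ℝ) (hne : graphGrad u (slice q) ≠ 0) :
    IsMeanCurvatureAt S p q
      (curvOp p (graphGrad u (slice q)) (hHess sliceFrame u (slice q))) := by
  have hslice := contDiff_slice.continuous.tendsto q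
  have hne' : ∀ᶠ x in 𝓝 q, graphGrad u (slice x) ≠ 0 := hslice.eventually
    ((continuousAt_graphGrad h.contDiffAt.self_of_nhds).eventually_ne hne)
  obtain ⟨V, hV, hVo, hqV⟩ := eventually_nhds_iff.1
    (h.mem_iff.and ((hslice.eventually h.contDiffAt).and hne'))
  have hφ : ∀ x ∈ V, ContDiffAt ℝ ∞ (graphFun u) x := fun x hx => contDiffAt_graphFun (hV x hx).2.1
  have hgrad : ∀ x ∈ V, hGrad frame (graphFun u) x = graphGrad u (slice x) := fun x hx =>
    hGrad_graphFun ((hV x hx).2.1.differentiableAt (by simp))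
  have hgrad_ne : ∀ x ∈ V, hGrad frame (graphFun u) x ≠ 0 := fun x hx =>
    (hgrad x hx).trans_ne (hV x hx).2.2
  refine ⟨h.mem, V, graphFun u, ⟨hVo, fun x hx => (hφ x hx).contDiffWithinAt,
    fun x hx => mt hGrad_eq_zero (hgrad_ne x hx), fun x hx => ?_⟩, hqV,
    ⟨1, one_pos, fun x _ a _ _ => graphFun_lTrans u a x⟩,
    fun x hx => coNorm_fderiv_ne_zero_iff.2 (hgrad_ne x hx), divergence (pNormal p (graphFun u)),
    satisfiesFirstVariation_divergence_pNormal p S hφ hgrad_ne, ?_⟩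
  · rw [(hV x hx).1, graphFun, sub_eq_zero, eq_comm]
  · rw [divergence_pNormal p (hφ q hqV) (hgrad_ne q hqV), hgrad q hqV,
      hHess_graphFun ((hV q hqV).2.1.of_le ENat.LEInfty.out)]

end IsGraphAt

theorem IsMeanCurvatureAt.eq_curvOp {p c : ℝ} (hc : IsMeanCurvatureAt S p q c)
    (h : IsGraphAt S u q) :
    c = curvOp p (graphGrad u (slice q)) (hHess sliceFrame u (slice q)) := by
  obtain ⟨-, V, φ, hφ, hqV, hcomp, hne, H, hH, rfl⟩ := hc
  have hφ' : ∀ x ∈ V, ContDiffAt ℝ ∞ φ x := fun x hx =>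
    hφ.contDiffOn.contDiffAt (hφ.isOpen.mem_nhds hx)
  have hne' : ∀ x ∈ V, hGrad frame φ x ≠ 0 := fun x hx => coNorm_fderiv_ne_zero_iff.1 (hne x hx)
  have hφS : ∀ x ∈ S ∩ V, φ x = 0 := fun x hx => (hφ.mem_iff x hx.2).1 hx.1
  have hφu := h.eventuallyEq_graphFun (hφ.isOpen.mem_nhds hqV) hφS hcomp
  obtain ⟨B, hB, hBo, hqB⟩ := eventually_nhds_iff.1 (h.contDiffAt.and
    (h.tendsto_graphMap.eventually (eventually_mem_nhdsWithin.and
      (nhdsWithin_le_nhds (hφ.isOpen.mem_nhds hqV)))))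
  have hγ : ∀ w ∈ B, ContDiffAt ℝ ∞ (graphMap u) w := fun w hw =>
    contDiffAt_graphMap (m := ⊤) (hB w hw).1
  have hHq := hH.eqOn_divergence_pNormal hφ' hne' hφS hBo
    (fun w hw => (hγ w hw).contDiffWithinAt)
    (Function.LeftInverse.injective (slice_graphMap u)).injOn
    (fun w hw => injective_fderiv_graphMap ((hγ w hw).differentiableAt (by simp)))
    (fun w hw => (hB w hw).2) hqB
  rw [Function.comp_apply, Function.comp_apply, h.graphMap_slice,
    divergence_pNormal p (hφ' q hqV) (hne' q hqV)] at hHq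
  have hu := h.contDiffAt.self_of_nhds
  rw [hHq, ← hGrad_graphFun (hu.differentiableAt (by simp)),
    ← hHess_graphFun (hu.of_le ENat.LEInfty.out), hGrad_congr hφu, hHess_congr hφu]

theorem IsGraphAt.meanCurvature_eq (h : IsGraphAt S u q) (p : ℝ) (hne : graphGrad u (slice q) ≠ 0) :
    meanCurvature S p q = curvOp p (graphGrad u (slice q)) (hHess sliceFrame u (slice q)) := by
  have hex := Exists.intro _ (h.isMeanCurvatureAt p hne)
  rw [meanCurvature, dif_pos hex]
  exact hex.choose_spec.eq_curvOp h

end Graph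

section ImplicitFunction

variable {𝕜 E₁ E₂ F : Type*} [RCLike 𝕜] [NormedAddCommGroup E₁] [NormedSpace 𝕜 E₁]
  [CompleteSpace E₁] [NormedAddCommGroup E₂] [NormedSpace 𝕜 E₂] [CompleteSpace E₂]
  [NormedAddCommGroup F] [NormedSpace 𝕜 F] [CompleteSpace F] {f : E₁ × E₂ → F} {m : ℕ∞ω}

theorem contDiffAt_of_eventually_apply_eq {u : E₁ → E₂} {x : E₁} (hm : m ≠ 0)
    (hf : ContDiffAt 𝕜 m f (x, u x)) (hinv : (fderiv 𝕜 f (x, u x) ∘L .inr 𝕜 E₁ E₂).IsInvertible)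
    (hu : ContinuousAt u x) (h : ∀ᶠ y in 𝓝 x, f (y, u y) = f (x, u x)) : ContDiffAt 𝕜 m u x := by
  refine (hf.contDiffAt_implicitFunction hm hinv).congr_of_eventuallyEq ?_
  filter_upwards [h, (continuousAt_id.prodMk hu).eventually
    (hf.eventually_apply_eq_iff_implicitFunction hm hinv)] with y hy hiff using (hiff.1 hy).symm

theorem eventually_contDiffAt_implicitFunction {P : E₁ × E₂} (hm : m ≠ 0)
    (hf : ∀ᶠ y in 𝓝 P, ContDiffAt 𝕜 m f y)
    (hinv : (fderiv 𝕜 f P ∘L .inr 𝕜 E₁ E₂).IsInvertible) :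
    ∀ᶠ x in 𝓝 P.1, ContDiffAt 𝕜 m (hf.self_of_nhds.implicitFunction hm hinv) x := by
  have hfP := hf.self_of_nhds
  set u := hfP.implicitFunction hm hinv
  have hu : ContDiffAt 𝕜 m u P.1 := hfP.contDiffAt_implicitFunction hm hinv
  have hu₁ : ∀ᶠ x in 𝓝 P.1, ContDiffAt 𝕜 1 u x :=
    (hu.of_le (ENat.one_le_iff_ne_zero_withTop.2 hm)).eventually (by simp)
  have hgraph : Tendsto (fun x => (x, u x)) (𝓝 P.1) (𝓝 P) := by
    have := continuousAt_id.prodMk hu.continuousAt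
    rwa [ContinuousAt, show (id P.1, u P.1) = P from
      Prod.ext rfl (hfP.implicitFunction_apply_self hm hinv)] at this
  have hinv' : ∀ᶠ y in 𝓝 P, (fderiv 𝕜 f y ∘L .inr 𝕜 E₁ E₂).IsInvertible := by
    obtain ⟨e, he⟩ := hinv
    have hcont : ContinuousAt (fun y => fderiv 𝕜 f y ∘L .inr 𝕜 E₁ E₂) P :=
      (hfP.continuousAt_fderiv hm).clm_comp continuousAt_const
    have hnhds := e.nhds
    rw [he] at hnhds
    exact hcont.eventually hnhds
  filter_upwards [hu₁, hgraph.eventually hf, hgraph.eventually hinv',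
    (hfP.eventually_apply_implicitFunction hm hinv).eventually_nhds] with x hx hfx hinvx hfu
  refine contDiffAt_of_eventually_apply_eq hm hfx hinvx hx.continuousAt ?_
  filter_upwards [hfu] with y hy using hy.trans hfu.self_of_nhds.symm

end ImplicitFunction

section GraphExistence

variable {n : ℕ} [NeZero n] {S : Set (Heis n)} {q : Heis n} {φ : Heis n → ℝ} {c : ℝ}

theorem fderiv_comp_orbitPoint (hφ : DifferentiableAt ℝ φ q)
    (hc : ∀ v, fderiv ℝ φ q v = c * (-ddx 0 ⬝ᵥ v)) :
    fderiv ℝ (fun y : OrbitSpace n × ℝ => φ (orbitPoint y.2 y.1))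
      (slice q, q (Sum.inl (Sum.inl 0))) = -c • ContinuousLinearMap.snd ℝ (OrbitSpace n) ℝ := by
  have hQ := (contDiff_orbitPoint.differentiable (by simp)
    (slice q, q (Sum.inl (Sum.inl 0)))).hasFDerivAt
  have hsnd : .proj (Sum.inl (Sum.inl 0)) ∘L fderiv ℝ (fun y => orbitPoint y.2 y.1)
      (slice q, q (Sum.inl (Sum.inl 0))) = ContinuousLinearMap.snd ℝ (OrbitSpace n) ℝ := by
    refine (hasFDerivAt_pi'.1 hQ _).unique ?_
    simp only [orbitPoint_apply_zero]
    exact hasFDerivAt_snd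
  rw [fderiv_fun_comp _ (by rwa [orbitPoint_slice]) hQ.differentiableAt, orbitPoint_slice]
  refine ContinuousLinearMap.ext fun v => ?_
  rw [← hsnd, ContinuousLinearMap.comp_apply, hc]
  simp [ddx]

theorem HasUnitNormalAt.exists_isGraphAt (h : HasUnitNormalAt S q (-ddx 0)) :
    ∃ u, IsGraphAt S u q ∧ fderiv ℝ u (slice q) = 0 := by
  obtain ⟨hqS, -, V, φ, hφ, hqV, c, hc, hn⟩ := h
  have hV := hφ.isOpen.mem_nhds hqV
  set P : OrbitSpace n × ℝ := (slice q, q (Sum.inl (Sum.inl 0)))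
  set f : OrbitSpace n × ℝ → ℝ := fun y => φ (orbitPoint y.2 y.1)
  have hφV : ∀ x ∈ V, ContDiffAt ℝ ∞ φ x := fun x hx =>
    hφ.contDiffOn.contDiffAt (hφ.isOpen.mem_nhds hx)
  have hf : ∀ᶠ y in 𝓝 P, ContDiffAt ℝ ∞ f y := by
    have hQP : Tendsto (fun y : OrbitSpace n × ℝ => orbitPoint y.2 y.1) (𝓝 P) (𝓝 q) := by
      simpa only [P, orbitPoint_slice] using contDiff_orbitPoint.continuous.tendsto P
    filter_upwards [hQP.eventually hV] with y hy
    exact (hφV _ hy).comp y contDiff_orbitPoint.contDiffAt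
  have hf' : fderiv ℝ f P = -c • ContinuousLinearMap.snd ℝ (OrbitSpace n) ℝ :=
    fderiv_comp_orbitPoint ((hφV q hqV).differentiableAt (by simp)) hn
  have hinv : (fderiv ℝ f P ∘L .inr ℝ (OrbitSpace n) ℝ).IsInvertible := by
    refine ⟨ContinuousLinearEquiv.unitsEquivAut ℝ (Units.mk0 (-c) (by simpa using hc.ne')), ?_⟩
    ext
    simp [hf']
  have hfP := hf.self_of_nhds
  refine ⟨hfP.implicitFunction (by simp) hinv,
    ⟨hqS, eventually_contDiffAt_implicitFunction (by simp) hf hinv, ?_⟩, ?_⟩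
  · have hsplit : Tendsto (fun x : Heis n => (slice x, x (Sum.inl (Sum.inl 0)))) (𝓝 q) (𝓝 P) :=
      (contDiff_slice.continuous.prodMk (continuous_apply _)).tendsto q
    have hP : f P = 0 := by
      dsimp only [f, P]
      rw [orbitPoint_slice, ← hφ.mem_iff q hqV]
      exact hqS
    filter_upwards [hV, hsplit.eventually
      (hfP.eventually_apply_eq_iff_implicitFunction (by simp) hinv)] with x hx hiff
    rw [hφ.mem_iff x hx, eq_comm (b := ContDiffAt.implicitFunction ..), ← hiff, hP]
    dsimp only [f]
    rw [orbitPoint_slice]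
  · rw [(hfP.hasStrictFDerivAt_implicitFunction (by simp) hinv).hasFDerivAt.fderiv, hf']
    ext
    simp

end GraphExistence

/-! ### The strong maximum principle -/

section ContactDistribution

variable {E κ : Type*} [NormedAddCommGroup E] [NormedSpace ℝ E] {Y : κ → E → E} {v : E → κ → ℝ}
  {k₀ k l : κ} {w : E}

/-- The vector fields `v k₀ • Y k - v k • Y k₀`. Where `v k₀ ≠ 0`, they span the combinations of
the `Y k` annihilated by the covector with values `v k`: if `v` is the horizontal derivative of a
defining function, these are the horizontal directions tangent to its level sets. -/
def contactField (Y : κ → E → E) (v : E → κ → ℝ) (k₀ k : κ) (x : E) : E :=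
  v x k₀ • Y k x - v x k • Y k₀ x

theorem contDiffAt_contactField (hY : ∀ k, ContDiffAt ℝ 1 (Y k) w)
    (hv : ∀ k, ContDiffAt ℝ 1 (fun x => v x k) w) (k₀ k : κ) :
    ContDiffAt ℝ 1 (contactField Y v k₀ k) w :=
  ((hv k₀).smul (hY k)).sub ((hv k).smul (hY k₀))

theorem apply_fderiv_contactField (hY : ∀ k, DifferentiableAt ℝ (Y k) w)
    (hv : ∀ k, DifferentiableAt ℝ (fun x => v x k) w) (hl : v w l = 0) {ℓ : E →L[ℝ] ℝ}
    (hℓ : ℓ (Y l w) = 0) (h : E) :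
    ℓ (fderiv ℝ (contactField Y v k₀ l) w h) =
      v w k₀ * ℓ (fderiv ℝ (Y l) w h) - fderiv ℝ (fun x => v x l) w h * ℓ (Y k₀ w) := by
  have hd : HasFDerivAt (contactField Y v k₀ l) _ w :=
    ((hv k₀).hasFDerivAt.smul (hY l).hasFDerivAt).sub
      ((hv l).hasFDerivAt.smul (hY k₀).hasFDerivAt)
  rw [hd.fderiv]
  simp [hl, hℓ]

theorem apply_lieBracket_contactField (hY : ∀ k, DifferentiableAt ℝ (Y k) w)
    (hv : ∀ k, DifferentiableAt ℝ (fun x => v x k) w) (hk : v w k = 0) (hl : v w l = 0)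
    (hcomm : fderiv ℝ (fun x => v x l) w (Y k w) = fderiv ℝ (fun x => v x k) w (Y l w))
    {ℓ : E →L[ℝ] ℝ} (hℓk : ℓ (Y k w) = 0) (hℓl : ℓ (Y l w) = 0) :
    ℓ (VectorField.lieBracket ℝ (contactField Y v k₀ k) (contactField Y v k₀ l) w) =
      v w k₀ ^ 2 * ℓ (VectorField.lieBracket ℝ (Y k) (Y l) w) := by
  have hfield : ∀ {m}, v w m = 0 → contactField Y v k₀ m w = v w k₀ • Y m w := fun hm => by
    simp [contactField, hm]
  simp only [VectorField.lieBracket_eq, map_sub, apply_fderiv_contactField hY hv hk hℓk,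
    apply_fderiv_contactField hY hv hl hℓl, hfield hk, hfield hl, map_smul, smul_eq_mul, hcomm]
  ring

end ContactDistribution

section StrongMaximumPrinciple

variable {κ : Type*} [Fintype κ] {p : ℝ} {e : κ → ℝ} {q : (κ → ℝ) × (κ → κ → ℝ)}

theorem contDiffAt_curvOp_sub (p : ℝ) (hq : q.1 ≠ e) :
    ContDiffAt ℝ ∞ (fun q : (κ → ℝ) × (κ → κ → ℝ) => curvOp p (q.1 - e) q.2) q :=
  (contDiffAt_curvOp p (sub_ne_zero.2 hq) q.2).comp
    (f := fun q : (κ → ℝ) × (κ → κ → ℝ) => (q.1 - e, q.2)) q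
    ((contDiffAt_fst.sub contDiffAt_const).prodMk contDiffAt_snd)

theorem fderiv_curvOp_sub_snd (p : ℝ) (hq : q.1 ≠ e) (C : κ → κ → ℝ) :
    fderiv ℝ (fun q : (κ → ℝ) × (κ → κ → ℝ) => curvOp p (q.1 - e) q.2) q (0, C) =
      curvOp p (q.1 - e) C := by
  have hline := ((contDiffAt_curvOp_sub p hq).differentiableAt
    (by simp)).hasFDerivAt.hasLineDerivAt (0, C)
  have haffine : HasDerivAt (fun t : ℝ => curvOp p (q.1 - e) q.2 + t * curvOp p (q.1 - e) C)
      (curvOp p (q.1 - e) C) 0 := by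
    simpa using ((hasDerivAt_id (0 : ℝ)).mul_const (curvOp p (q.1 - e) C)).const_add
      (curvOp p (q.1 - e) q.2)
  refine HasDerivAt.unique ?_ haffine
  simpa [HasLineDerivAt, curvOp_add_smul] using hline

theorem isEllipticAt_curvOp_sub (hp : 0 ≤ p) (hq : q.1 ≠ e) :
    IsEllipticAt (fun q => curvOp p (q.1 - e) q.2) q := by
  filter_upwards [continuousAt_fst.eventually_ne hq] with q' hq' B hB
  have h := curvOp_add_smul p (q'.1 - e) q'.2 B 1
  rw [one_smul, one_mul] at h
  simpa [h] using curvOp_nonneg hp (sub_ne_zero.2 hq') hB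

variable {E : Type*} [NormedAddCommGroup E] [NormedSpace ℝ E] [FiniteDimensional ℝ E]
  {Y : κ → E → E} {u₁ u₂ : E → ℝ} {k₀ : κ} {w z : E}

theorem parallel_of_isProximalNormal (hp : 0 ≤ p) (hY : ∀ k, ContDiff ℝ 1 (Y k))
    (hu₁ : ContDiffAt ℝ 2 u₁ z) (hu₂ : ContDiffAt ℝ 2 u₂ z) (hle : ∀ᶠ x in 𝓝 z, u₁ x ≤ u₂ x)
    (hcurv : ∀ᶠ x in 𝓝 z, curvOp p (hGrad Y u₂ x - e) (hHess Y u₂ x) ≤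
      curvOp p (hGrad Y u₁ x - e) (hHess Y u₁ x))
    (hz : u₁ z = u₂ z) (hne : hGrad Y u₁ z ≠ e) {Z : Set E}
    (hZ : ∀ᶠ x in 𝓝 z, u₁ x = u₂ x → x ∈ Z) {ℓ : E →L[ℝ] ℝ} (hℓ : IsProximalNormal Z z ℓ)
    (k l : κ) : (hGrad Y u₁ z - e) l * ℓ (Y k z) = (hGrad Y u₁ z - e) k * ℓ (Y l z) := by
  obtain ⟨Φ, hΦ, rfl, hmax⟩ := hℓ.exists_contDiff
  have hrank := apply_rankOne_nonpos_of_contact hY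
    ((contDiffAt_curvOp_sub p hne).hasStrictFDerivAt (by simp)) (isEllipticAt_curvOp_sub hp hne)
    hu₁ hu₂ hle hcurv hz (hΦ.of_le ENat.LEInfty.out).contDiffAt
    ((eventually_nhdsWithin_iff.1 hmax).mp <| hZ.mono fun x hxZ hx hx12 => hx (hxZ hx12))
  rw [fderiv_curvOp_sub_snd p hne] at hrank
  exact parallel_of_curvOp_rankOne_nonpos hp (sub_ne_zero.2 hne) hrank k l

/-- The proximal normals of the coincidence set annihilate the contact fields, because the
linearized operator is elliptic in the contact directions. -/
theorem eventually_eq_of_curvOp_le (hp : 0 ≤ p) (hY : ∀ k, ContDiff ℝ 1 (Y k))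
    (hu₁ : ContDiffAt ℝ 2 u₁ w) (hu₂ : ContDiffAt ℝ 2 u₂ w) (hle : ∀ᶠ x in 𝓝 w, u₁ x ≤ u₂ x)
    (hcurv : ∀ᶠ x in 𝓝 w, curvOp p (hGrad Y u₂ x - e) (hHess Y u₂ x) ≤
      curvOp p (hGrad Y u₁ x - e) (hHess Y u₁ x))
    (hw : u₁ w = u₂ w) (hne : hGrad Y u₁ w ≠ e)
    (hspan : ∀ ℓ : E →L[ℝ] ℝ,
      (∀ k, ℓ (contactField Y (fun x => hGrad Y u₁ x - e) k₀ k w) = 0) →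
      (∀ k l, ℓ (VectorField.lieBracket ℝ (contactField Y (fun x => hGrad Y u₁ x - e) k₀ k)
        (contactField Y (fun x => hGrad Y u₁ x - e) k₀ l) w) = 0) → ℓ = 0) :
    ∀ᶠ x in 𝓝 w, u₁ x = u₂ x := by
  have hgrad : ∀ k, ContDiffAt ℝ 1 (fun x => hGrad Y u₁ x k) w := fun k =>
    (hu₁.fderiv_right (m := 1) (by norm_num)).clm_apply (hY k).contDiffAt
  have hne' : ∀ᶠ z in 𝓝 w, hGrad Y u₁ z ≠ e :=
    (continuousAt_pi.2 fun k => (hgrad k).continuousAt).eventually_ne hne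
  have hev := (hu₁.eventually (by simp)).and <| (hu₂.eventually (by simp)).and <|
    hle.eventually_nhds.and <| hcurv.eventually_nhds.and hne'
  obtain ⟨r, hr, hball⟩ := Metric.nhds_basis_closedBall.eventually_iff.1 hev
  set Z := {x | x ∈ Metric.closedBall w r ∧ u₁ x - u₂ x = 0}
  have hcont : ContinuousOn (fun x => u₁ x - u₂ x) (Metric.closedBall w r) := fun x hx =>
    ((hball hx).1.continuousAt.sub (hball hx).2.1.continuousAt).continuousWithinAt
  have hclosed : IsClosed Z :=
    hcont.preimage_isClosed_of_isClosed Metric.isClosed_closedBall isClosed_singleton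
  have hwZ : w ∈ Z := ⟨Metric.mem_closedBall_self hr.le, sub_eq_zero.2 hw⟩
  refine mem_of_superset (mem_nhds_of_forall_isProximalNormal_lieBracket hclosed hwZ
    (contDiffAt_contactField (fun k => (hY k).contDiffAt)
      (fun k => (hgrad k).sub contDiffAt_const) k₀) ?_ hspan) fun x hx => sub_eq_zero.1 hx.2
  filter_upwards [Metric.ball_mem_nhds w hr] with z hzr hz ℓ hℓ k
  obtain ⟨hz₁, hz₂, hzle, hzcurv, hzne⟩ := hball hz.1
  have hZ : ∀ᶠ x in 𝓝 z, u₁ x = u₂ x → x ∈ Z := by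
    filter_upwards [Metric.isOpen_ball.mem_nhds hzr] with x hx hx12
    exact ⟨Metric.ball_subset_closedBall hx, sub_eq_zero.2 hx12⟩
  have h := parallel_of_isProximalNormal hp hY hz₁ hz₂ hzle hzcurv (sub_eq_zero.1 hz.2) hzne hZ
    hℓ k k₀
  simpa [contactField, sub_eq_zero] using h

theorem eventually_eq_of_curvOp_le_of_fderiv_eq_zero [DecidableEq κ] (hp : 0 ≤ p)
    (hY : ∀ k, ContDiff ℝ 1 (Y k))
    (hu₁ : ContDiffAt ℝ 2 u₁ w) (hu₂ : ContDiffAt ℝ 2 u₂ w) (hle : ∀ᶠ x in 𝓝 w, u₁ x ≤ u₂ x)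
    (hcurv : ∀ᶠ x in 𝓝 w, curvOp p (hGrad Y u₂ x - Pi.single k₀ 1) (hHess Y u₂ x) ≤
      curvOp p (hGrad Y u₁ x - Pi.single k₀ 1) (hHess Y u₁ x))
    (hw : u₁ w = u₂ w) (hcrit : fderiv ℝ u₁ w = 0)
    (hspan : ∀ ℓ : E →L[ℝ] ℝ, (∀ k ≠ k₀, ℓ (Y k w) = 0) →
      (∀ k ≠ k₀, ∀ l ≠ k₀, ℓ (VectorField.lieBracket ℝ (Y k) (Y l) w) = 0) → ℓ = 0) :
    ∀ᶠ x in 𝓝 w, u₁ x = u₂ x := by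
  have hYd : ∀ k, DifferentiableAt ℝ (Y k) w := fun k => (hY k).differentiable one_ne_zero w
  have hgrad := hGrad_eq_zero (Y := Y) hcrit
  set v : E → κ → ℝ := fun x => hGrad Y u₁ x - Pi.single k₀ 1 with hv
  have hvw : v w = -Pi.single k₀ 1 := by simp [hv, hgrad]
  have hv₀ : v w k₀ = -1 := by simp [hvw]
  have hvk : ∀ k ≠ k₀, v w k = 0 := fun k hk => by simp [hvw, hk]
  have hvd : ∀ k, DifferentiableAt ℝ (fun x => v x k) w := fun k =>
    ((differentiableAt_fderiv_of_contDiffAt_two hu₁).clm_apply (hYd k)).sub_const _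
  have hcomm : ∀ k l, fderiv ℝ (fun x => v x l) w (Y k w) = fderiv ℝ (fun x => v x k) w (Y l w) :=
    fun k l => by
      simpa [hv, hHess, fderiv_sub_const] using hHess_comm_of_fderiv_eq_zero hu₁ hYd hcrit k l
  refine eventually_eq_of_curvOp_le (e := Pi.single k₀ 1) (k₀ := k₀) hp hY hu₁ hu₂ hle hcurv hw
    ?_ fun ℓ hℓ hbracket => ?_
  · rw [hgrad]
    exact fun h => by simpa using congrFun h k₀
  have hℓY : ∀ k ≠ k₀, ℓ (Y k w) = 0 := fun k hk => by
    simpa [contactField, hgrad, hk] using hℓ k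
  refine hspan ℓ hℓY fun k hk l hl => ?_
  have h := apply_lieBracket_contactField (k₀ := k₀) hYd hvd (hvk k hk) (hvk l hl) (hcomm k l)
    (hℓY k hk) (hℓY l hl)
  rw [hbracket, hv₀] at h
  simpa using h.symm

end StrongMaximumPrinciple

section SliceFrame

variable {n : ℕ} [NeZero n] {w : OrbitSpace n}

theorem sliceFrame_of_ne {k : Fin n ⊕ Fin n} (hk : k ≠ Sum.inl 0) (w : OrbitSpace n) :
    sliceFrame k w = Pi.single k 1 + sliceFrame k w (Sum.inl 0) • Pi.single (Sum.inl 0) 1 := by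
  rcases k with j | j
  · have hj : j ≠ 0 := fun h => hk (by rw [h])
    simp [sliceFrame, hj, hj.symm]
  · by_cases hj : j = 0
    · simp [sliceFrame, hj]
    · simp [sliceFrame, hj, sub_eq_add_neg]

theorem lieBracket_sliceFrame {m : Fin n} (hm : m ≠ 0) (w : OrbitSpace n) :
    VectorField.lieBracket ℝ (sliceFrame (Sum.inl m)) (sliceFrame (Sum.inr m)) w =
      (-2 : ℝ) • Pi.single (Sum.inl 0) 1 := by
  have hl : sliceFrame (n := n) (Sum.inl m) = fun w =>
      Pi.single (Sum.inl m) 1 + w (Sum.inr m) • Pi.single (Sum.inl 0) 1 := by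
    funext w; simp [sliceFrame, hm]
  have hr : sliceFrame (n := n) (Sum.inr m) = fun w =>
      Pi.single (Sum.inr m) 1 - w (Sum.inl m) • Pi.single (Sum.inl 0) 1 := by
    funext w; simp [sliceFrame, hm]
  have hdl : HasFDerivAt (sliceFrame (n := n) (Sum.inl m)) _ w := hl ▸
    ((hasFDerivAt_apply (𝕜 := ℝ) (Sum.inr m) w).smul_const _).const_add _
  have hdr : HasFDerivAt (sliceFrame (n := n) (Sum.inr m)) _ w := hr ▸
    ((hasFDerivAt_apply (𝕜 := ℝ) (Sum.inl m) w).smul_const _).const_sub _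
  rw [VectorField.lieBracket, hdl.fderiv, hdr.fderiv]
  simp only [hl, hr]
  simp only [neg_apply, ContinuousLinearMap.smulRight_apply, ContinuousLinearMap.proj_apply,
    Pi.add_apply, Pi.sub_apply, Pi.smul_apply, Pi.single_eq_same, ne_eq, Sum.inl.injEq, hm,
    not_false_eq_true, Pi.single_eq_of_ne, reduceCtorEq, smul_eq_mul, mul_zero, add_zero, sub_zero,
    one_smul, neg_smul]
  module

theorem eq_zero_of_apply_sliceFrame_eq_zero (hn : 2 ≤ n) {ℓ : OrbitSpace n →L[ℝ] ℝ}
    (hframe : ∀ k ≠ Sum.inl 0, ℓ (sliceFrame k w) = 0)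
    (hbracket : ∀ k ≠ Sum.inl 0, ∀ l ≠ Sum.inl 0,
      ℓ (VectorField.lieBracket ℝ (sliceFrame k) (sliceFrame l) w) = 0) : ℓ = 0 := by
  obtain ⟨m, hm⟩ : ∃ m : Fin n, m ≠ 0 :=
    haveI := Fin.nontrivial_iff_two_le.2 hn
    exists_ne 0
  have h₀ : ℓ (Pi.single (Sum.inl 0) 1) = 0 := by
    simpa [lieBracket_sliceFrame hm] using
      hbracket (Sum.inl m) (fun h => hm (Sum.inl_injective h)) (Sum.inr m) Sum.inr_ne_inl
  refine ContinuousLinearMap.coe_injective (LinearMap.pi_ext' fun k => LinearMap.ext_ring ?_)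
  by_cases hk : k = Sum.inl 0
  · simpa [hk] using h₀
  · have h := hframe k hk
    rw [sliceFrame_of_ne hk, map_add, map_smul, h₀, smul_zero, add_zero] at h
    simpa using h

end SliceFrame

section Coincidence

variable {n : ℕ} [NeZero n] {S S₁ S₂ : Set (Heis n)} {u u₁ u₂ : OrbitSpace n → ℝ}
  {w : OrbitSpace n} {q : Heis n}

theorem eventually_graphGrad_ne_zero (hu : ContDiffAt ℝ ∞ u w) (hcrit : fderiv ℝ u w = 0) :
    ∀ᶠ w in 𝓝 w, graphGrad u w ≠ 0 := by
  refine (continuousAt_graphGrad hu).eventually_ne ?_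
  rw [graphGrad, hGrad_eq_zero hcrit]
  exact fun h => by simpa using congrFun h (Sum.inl 0)

namespace IsGraphAt

theorem eventually_meanCurvature_graphMap_eq (h : IsGraphAt S u q)
    (hcrit : fderiv ℝ u (slice q) = 0) (p : ℝ) : ∀ᶠ w in 𝓝 (slice q),
      meanCurvature S p (graphMap u w) = curvOp p (graphGrad u w) (hHess sliceFrame u w) := by
  filter_upwards [h.tendsto_graphMap.eventually h.eventually_isGraphAt,
    eventually_graphGrad_ne_zero h.contDiffAt.self_of_nhds hcrit] with w hw hne
  rw [hw.meanCurvature_eq p (by rwa [slice_graphMap]), slice_graphMap]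

theorem eventually_eq_add_of_lTrans_mem {a : Heis n → ℝ} (h₁ : IsGraphAt S₁ u₁ q)
    (h₂ : IsGraphAt S₂ u₂ q) (ha : Tendsto a (𝓝[S₁] q) (𝓝 0))
    (h : ∀ᶠ x in 𝓝[S₁] q, lTrans (a x) x ∈ S₂) :
    ∀ᶠ w in 𝓝 (slice q), u₂ w = u₁ w + a (graphMap u₁ w) := by
  have hcont : Continuous fun y : ℝ × Heis n => lTrans y.1 y.2 := by
    unfold lTrans
    fun_prop
  have hlim : Tendsto (fun x => lTrans (a x) x) (𝓝[S₁] q) (𝓝 q) := by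
    simpa [lTrans, Function.comp_def] using
      (hcont.tendsto (0, q)).comp (ha.prodMk_nhds nhdsWithin_le_nhds)
  filter_upwards [h₁.tendsto_graphMap.eventually ((hlim.eventually h₂.mem_iff).and h)]
    with w ⟨hiff, hmem⟩
  have hw := hiff.1 hmem
  rw [graphMap, lTrans_orbitPoint, orbitPoint_apply_zero, slice_orbitPoint] at hw
  exact hw.symm

theorem exists_inter_eq_inter (h₁ : IsGraphAt S₁ u₁ q) (h₂ : IsGraphAt S₂ u₂ q)
    (h : ∀ᶠ w in 𝓝 (slice q), u₁ w = u₂ w) :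
    ∃ U : Set (Heis n), IsOpen U ∧ q ∈ U ∧ S₁ ∩ U = S₂ ∩ U := by
  have hiff : ∀ᶠ x in 𝓝 q, x ∈ S₁ ↔ x ∈ S₂ := by
    filter_upwards [h₁.mem_iff, h₂.mem_iff, contDiff_slice.continuous.continuousAt.eventually h]
      with x hx₁ hx₂ hx
    rw [hx₁, hx₂, hx]
  obtain ⟨U, hU, hUo, hqU⟩ := eventually_nhds_iff.1 hiff
  exact ⟨U, hUo, hqU, Set.ext fun x => and_congr_left (hU x)⟩

end IsGraphAt

end Coincidence

end Heisenberg

end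

open Heisenberg in
theorem corollaryD (n : ℕ) [NeZero n] (hn : 2 ≤ n) (p : ℝ) (hp : 0 ≤ p)
    (S₁ S₂ : Set (Heisenberg.Heis n)) (p₀ : Heisenberg.Heis n)
    (h₁ : Heisenberg.HasUnitNormalAt S₁ p₀ (-Heisenberg.ddx 0))
    (h₂ : Heisenberg.HasUnitNormalAt S₂ p₀ (-Heisenberg.ddx 0))
    (a : Heisenberg.Heis n → ℝ) (ha : Tendsto a (𝓝[S₁] p₀) (𝓝 0))
    (h : ∀ᶠ q in 𝓝[S₁] p₀, 0 ≤ a q ∧ Heisenberg.lTrans (a q) q ∈ S₂ ∧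
      Heisenberg.meanCurvature S₂ p (Heisenberg.lTrans (a q) q) ≤
        Heisenberg.meanCurvature S₁ p q) :
    ∃ U : Set (Heisenberg.Heis n), IsOpen U ∧ p₀ ∈ U ∧ S₁ ∩ U = S₂ ∩ U := by
  obtain ⟨u₁, hu₁, hcrit₁⟩ := h₁.exists_isGraphAt
  obtain ⟨u₂, hu₂, hcrit₂⟩ := h₂.exists_isGraphAt
  have hadd := hu₁.eventually_eq_add_of_lTrans_mem hu₂ ha (h.mono fun q hq => hq.2.1)
  have hle : ∀ᶠ w in 𝓝 (slice p₀), u₁ w ≤ u₂ w := by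
    filter_upwards [hadd, hu₁.tendsto_graphMap.eventually h] with w hw hq
    linarith [hq.1]
  have hcurv : ∀ᶠ w in 𝓝 (slice p₀), curvOp p (graphGrad u₂ w) (hHess sliceFrame u₂ w) ≤
      curvOp p (graphGrad u₁ w) (hHess sliceFrame u₁ w) := by
    filter_upwards [hadd, hu₁.tendsto_graphMap.eventually h,
      hu₁.eventually_meanCurvature_graphMap_eq hcrit₁ p,
      hu₂.eventually_meanCurvature_graphMap_eq hcrit₂ p] with w hw hq hw₁ hw₂
    rw [← hw₁, ← hw₂, graphMap, hw, ← lTrans_orbitPoint]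
    exact hq.2.2
  exact hu₁.exists_inter_eq_inter hu₂ <| eventually_eq_of_curvOp_le_of_fderiv_eq_zero hp
    (fun k => (contDiff_sliceFrame k).of_le (by simp))
    (hu₁.contDiffAt.self_of_nhds.of_le ENat.LEInfty.out)
    (hu₂.contDiffAt.self_of_nhds.of_le ENat.LEInfty.out) hle hcurv
    (hu₁.apply_slice.trans hu₂.apply_slice.symm) hcrit₁
    fun ℓ => eq_zero_of_apply_sliceFrame_eq_zero hn
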